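/- \textbf{Conventions.} Let $X\subseteq\omega$ and let $(\Phi^X_e)_{e\in\omega}$ be the standard numbering of the partial functions computable with oracle $X$. Let $L$ be an $X$-computable first-order language: its symbols are numbered so that, with oracle $X$, one can decide which numbers are those of function symbols (including constants) and of relation symbols, and compute their arities. The atomic diagram of an $L$-structure $\mathcal B$ with domain $\omega$ is the set of (G\"odel numbers of) atomic sentences and negations of atomic sentences, in $L$ with a constant for each element of $\omega$, that are true in $\mathcal B$. An index $e$ gives the atomic diagram of $\mathcal B$ if $\Phi^X_e$ is the characteristic function of that diagram. A structure is $X$-computable if it is isomorphic to a structure with domain $\omega$ whose atomic diagram is computable in $X$. The index set $I^X(\mathcal A)$ is the set of all $e$ such that $\Phi^X_e$ gives the atomic diagram of a structure with domain $\omega$ isomorphic to $\mathcal A$. A set $S\subseteq\omega$ is $\Sigma^0_3(X)$ if there is an $X$-computable relation $R$ with $n\in S\iff\exists a\,\forall b\,\exists c\,R(n,a,b,c)$. A set is $\Sigma^0_3(X)$ $m$-complete if it is $\Sigma^0_3(X)$ and every $\Sigma^0_3(X)$ set $S$ is reducible to it by a computable function $f$, i.e. $n\in S$ if and only if $f(n)$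 lies in it. A substructure $\mathcal N\subseteq\mathcal M$ is $\Sigma^0_1$-elementary, $\mathcal N\preceq_1\mathcal M$, if for each existential formula $\varphi(\bar x)$ and $\bar b\in\mathcal N$, $\mathcal M\models\varphi(\bar b)$ if and only if $\mathcal N\models\varphi(\bar b)$. A finitely generated structure $\mathcal A$ is self-reflective if it has a proper substructure that is isomorphic to $\mathcal A$ and $\Sigma^0_1$-elementary in $\mathcal A$. \textbf{Theorem.} Let $\mathcal A$ be a finitely generated $L$-structure that is $X$-computable and self-reflective. Then $I^X(\mathcal A)$ is $\Sigma^0_3(X)$ $m$-complete. Moreover, for each $\Sigma^0_3(X)$ set $S$ there is a computable function $f$ such that, for every $n$, $\Phi^X_{f(n)}$ gives the atomic diagram of an $L$-structure $\mathcal B_n$ with domain $\omega$, where \begin{enumerate} \item if $n\in S$, then $\mathcal B_n\cong\mathcal A$; \item if $n\notin S$, then $\mathcal B_n$ is not finitely generated, and it is the union of a strictly increasing chain $\mathcal C_0\prec_1\mathcal C_1\prec_1\mathcal C_2\prec_1\cdots$ of substructures, each isomorphic to $\mathcal A$ and each $\Sigma^0_1$-elementary in the next. \end{enumerate} -/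

import Mathlib

open scoped FirstOrder

universe u v w

namespace IndexSets

/-! ### Oracle machines and their numbering -/

/-- The characteristic function of a set of natural numbers. -/
noncomputable def charFun (S : Set ℕ) : ℕ → ℕ :=
  S.indicator fun _ => 1

/-- The characteristic function of `X`, as an oracle for `RecursiveIn` and `ComputableIn`. -/
noncomputable def oracleOf (X : Set ℕ) : Set (ℕ →. ℕ) :=
  {((charFun X : ℕ → ℕ) : ℕ →. ℕ)}

/-- Programs for functions that are partial recursive relative to an oracle: the programs
`Nat.Partrec.Code` of Mathlib with one more basic instruction, the query to the oracle. -/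
inductive OracleCode : Type
  | zero : OracleCode
  | succ : OracleCode
  | left : OracleCode
  | right : OracleCode
  | query : OracleCode
  | pair : OracleCode → OracleCode → OracleCode
  | comp : OracleCode → OracleCode → OracleCode
  | prec : OracleCode → OracleCode → OracleCode
  | rfind' : OracleCode → OracleCode

namespace OracleCode

/-- The partial function computed by a program with oracle `g`. -/
def eval (g : ℕ → ℕ) : OracleCode → ℕ →. ℕ
  | zero => fun _ => Part.some 0
  | succ => ((Nat.succ : ℕ → ℕ) : ℕ →. ℕ)
  | left => ((fun n : ℕ => n.unpair.1 : ℕ → ℕ) : ℕ →. ℕ)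
  | right => ((fun n : ℕ => n.unpair.2 : ℕ → ℕ) : ℕ →. ℕ)
  | query => (g : ℕ →. ℕ)
  | pair cf cg => fun n => Nat.pair <$> eval g cf n <*> eval g cg n
  | comp cf cg => fun n => eval g cg n >>= eval g cf
  | prec cf cg =>
    Nat.unpaired fun a n =>
      n.rec (eval g cf a) fun y IH => do
        let i ← IH
        eval g cg (Nat.pair a (Nat.pair y i))
  | rfind' cf =>
    Nat.unpaired fun a m =>
      (Nat.rfind fun n => (fun m => m = 0) <$> eval g cf (Nat.pair a (n + m))).map (· + m)

/-- The Gödel number of a program. -/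
def encodeCode : OracleCode → ℕ
  | zero => 0
  | succ => 1
  | left => 2
  | right => 3
  | query => 4
  | pair cf cg => 2 * (2 * Nat.pair (encodeCode cf) (encodeCode cg)) + 5
  | comp cf cg => 2 * (2 * Nat.pair (encodeCode cf) (encodeCode cg) + 1) + 5
  | prec cf cg => (2 * (2 * Nat.pair (encodeCode cf) (encodeCode cg)) + 1) + 5
  | rfind' cf => (2 * (2 * encodeCode cf + 1) + 1) + 5

/-- The program with a given Gödel number. -/
def ofNatCode : ℕ → OracleCode
  | 0 => zero
  | 1 => succ
  | 2 => left
  | 3 => right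
  | 4 => query
  | n + 5 =>
    let m := n.div2.div2
    have hm : m < n + 5 := by
      simp only [m, Nat.div2_val]
      omega
    have _m1 : m.unpair.1 < n + 5 := lt_of_le_of_lt m.unpair_left_le hm
    have _m2 : m.unpair.2 < n + 5 := lt_of_le_of_lt m.unpair_right_le hm
    match n.bodd, n.div2.bodd with
    | false, false => pair (ofNatCode m.unpair.1) (ofNatCode m.unpair.2)
    | false, true => comp (ofNatCode m.unpair.1) (ofNatCode m.unpair.2)
    | true, false => prec (ofNatCode m.unpair.1) (ofNatCode m.unpair.2)
    | true, true => rfind' (ofNatCode m)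
decreasing_by all_goals simp only [m] at *; omega

theorem ofNatCode_encodeCode (c : OracleCode) : ofNatCode (encodeCode c) = c := by
  induction c <;> simp [encodeCode, ofNatCode, Nat.div2_val, *]

theorem encodeCode_ofNatCode : ∀ n, encodeCode (ofNatCode n) = n
  | 0 => by simp [ofNatCode, encodeCode]
  | 1 => by simp [ofNatCode, encodeCode]
  | 2 => by simp [ofNatCode, encodeCode]
  | 3 => by simp [ofNatCode, encodeCode]
  | 4 => by simp [ofNatCode, encodeCode]
  | n + 5 => by
    let m := n.div2.div2
    have hm : m < n + 5 := by
      simp only [m, Nat.div2_val]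
      omega
    have _m1 : m.unpair.1 < n + 5 := lt_of_le_of_lt m.unpair_left_le hm
    have _m2 : m.unpair.2 < n + 5 := lt_of_le_of_lt m.unpair_right_le hm
    have IH := encodeCode_ofNatCode m
    have IH1 := encodeCode_ofNatCode m.unpair.1
    have IH2 := encodeCode_ofNatCode m.unpair.2
    conv_rhs => rw [← Nat.bit_bodd_div2 n, ← Nat.bit_bodd_div2 n.div2]
    simp only [ofNatCode.eq_6]
    cases n.bodd <;> cases n.div2.bodd <;>
      simp [m, encodeCode, IH, IH1, IH2, Nat.bit_val]
decreasing_by all_goals simp only [m] at *; omega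

end OracleCode

/-- `Phi X e` is the `e`-th partial function that is computable with oracle `X`. -/
noncomputable def Phi (X : Set ℕ) (e : ℕ) : ℕ →. ℕ :=
  (OracleCode.ofNatCode e).eval (charFun X)

/-- The functions `Phi X e` are exactly those that are partial recursive in `X`. -/
theorem exists_Phi_eq_iff (X : Set ℕ) (f : ℕ →. ℕ) :
    (∃ e, Phi X e = f) ↔ Nat.RecursiveIn (oracleOf X) f := by
  constructor
  · rintro ⟨e, rfl⟩
    unfold Phi
    induction OracleCode.ofNatCode e with
    | zero => exact .zero
    | succ => exact .succ
    | left => exact .left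
    | right => exact .right
    | query => exact .oracle _ rfl
    | pair cf cg hf hg => exact .pair hf hg
    | comp cf cg hf hg => exact .comp hf hg
    | prec cf cg hf hg => exact .prec hf hg
    | rfind' cf hf =>
      have key : Nat.RecursiveIn {OracleCode.eval (charFun X) cf}
          (OracleCode.eval (charFun X) (.rfind' cf)) := by
        have h1 : Nat.RecursiveIn {OracleCode.eval (charFun X) cf}
            (fun p => Part.some (Nat.pair p.unpair.1.unpair.1 (p.unpair.2 + p.unpair.1.unpair.2))) :=
          Nat.Primrec.recursiveIn (Primrec.nat_iff.1 (Primrec₂.natPair.comp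
            (Primrec.fst.comp (Primrec.unpair.comp (Primrec.fst.comp Primrec.unpair)))
            (Primrec.nat_add.comp (Primrec.snd.comp Primrec.unpair)
              (Primrec.snd.comp (Primrec.unpair.comp (Primrec.fst.comp Primrec.unpair))))))
        have h2 : Nat.RecursiveIn {OracleCode.eval (charFun X) cf}
            (fun p => Part.some (p.unpair.1 + p.unpair.2)) :=
          Nat.Primrec.recursiveIn (Primrec.nat_iff.1 (Primrec.nat_add.comp
            (Primrec.fst.comp Primrec.unpair) (Primrec.snd.comp Primrec.unpair)))
        refine (Nat.RecursiveIn.comp h2 (.pair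
          (.rfind (.comp (.oracle _ (Set.mem_singleton _)) h1)) .right)).of_eq fun a => ?_
        have h3 (k : ℕ) : (Part.some k >>= OracleCode.eval (charFun X) cf) =
            OracleCode.eval (charFun X) cf k := Part.bind_some _ _
        ext x
        simp [OracleCode.eval, Nat.unpaired, Seq.seq, h3, eq_comm]
      exact key.subst fun g hg => by rw [Set.mem_singleton_iff.1 hg]; exact hf
  · intro h
    suffices H : ∃ c : OracleCode, c.eval (charFun X) = f by
      obtain ⟨c, rfl⟩ := H
      exact ⟨c.encodeCode, by rw [Phi, OracleCode.ofNatCode_encodeCode]⟩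
    induction h with
    | zero => exact ⟨.zero, rfl⟩
    | succ => exact ⟨.succ, rfl⟩
    | left => exact ⟨.left, rfl⟩
    | right => exact ⟨.right, rfl⟩
    | oracle g hg => exact ⟨.query, (Set.mem_singleton_iff.1 hg).symm⟩
    | pair _ _ hf hg =>
      obtain ⟨cf, rfl⟩ := hf
      obtain ⟨cg, rfl⟩ := hg
      exact ⟨.pair cf cg, rfl⟩
    | comp _ _ hf hg =>
      obtain ⟨cf, rfl⟩ := hf
      obtain ⟨cg, rfl⟩ := hg
      exact ⟨.comp cf cg, rfl⟩
    | prec _ _ hf hg =>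
      obtain ⟨cf, rfl⟩ := hf
      obtain ⟨cg, rfl⟩ := hg
      exact ⟨.prec cf cg, rfl⟩
    | rfind _ hf =>
      obtain ⟨cf, rfl⟩ := hf
      refine ⟨.comp (.rfind' cf) (.pair (.pair .left .right) .zero), ?_⟩
      funext a
      simp [OracleCode.eval, Seq.seq, Part.map_id']

/-! ### The class `Σ⁰₃(X)` and completeness -/

/-- `S` is `Σ⁰₃(X)`: there is an `X`-computable relation `R` such that
`n ∈ S ↔ ∃ a, ∀ b, ∃ c, R n a b c`. -/
def IsSigma3 (X S : Set ℕ) : Prop :=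
  ∃ R : ℕ → ℕ → ℕ → ℕ → Bool,
    ComputableIn (oracleOf X) (fun p : ℕ × ℕ × ℕ × ℕ => R p.1 p.2.1 p.2.2.1 p.2.2.2) ∧
    ∀ n, n ∈ S ↔ ∃ a, ∀ b, ∃ c, R n a b c = true

/-- `I` is `m`-complete for `Σ⁰₃(X)`: it belongs to the class, and every member of the class is
many-one reducible to it. The reductions are computable outright, not merely computable in `X`. -/
def IsSigma3Complete (X I : Set ℕ) : Prop :=
  IsSigma3 X I ∧ ∀ S : Set ℕ, IsSigma3 X S → ManyOneReducible (fun n => n ∈ S) (fun e => e ∈ I)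

/-! ### Atomic diagrams -/

section Diagram

variable (L : FirstOrder.Language.{u, v})

/-- An atomic sentence of the language `L` expanded by a constant for each natural number; the
closed terms of that language are the `L`-terms whose variables are natural numbers. -/
inductive AtomicSentence : Type (max u v)
  | equal (t s : L.Term ℕ) : AtomicSentence
  | rel {n : ℕ} (R : L.Relations n) (ts : Fin n → L.Term ℕ) : AtomicSentence

variable {L}

/-- Truth of an atomic sentence in a structure with domain `ℕ`, each number naming itself. -/
def AtomicSentence.Holds (B : L.Structure ℕ) : AtomicSentence L → Prop
  | .equal t s => t.realize id = s.realize id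
  | .rel R ts => FirstOrder.Language.Structure.RelMap R fun i => (ts i).realize id

variable [Encodable ((n : ℕ) × L.Functions n)] [Encodable ((n : ℕ) × L.Relations n)]

/-- The Gödel number of an atomic sentence; terms are numbered by their words in Polish notation,
as in Mathlib. -/
def AtomicSentence.code : AtomicSentence L → ℕ
  | .equal t s => 2 * Nat.pair (Encodable.encode t) (Encodable.encode s)
  | .rel (n := n) R ts =>
    2 * Nat.pair (Encodable.encode (⟨n, R⟩ : (n : ℕ) × L.Relations n))
      (Encodable.encode (List.ofFn fun i => Encodable.encode (ts i))) + 1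

/-- Distinct atomic sentences have distinct Gödel numbers. -/
theorem AtomicSentence.code_injective :
    Function.Injective (AtomicSentence.code : AtomicSentence L → ℕ) := by
  rintro (⟨t, s⟩ | ⟨R, ts⟩) (⟨t', s'⟩ | ⟨R', ts'⟩) h
  · simp only [AtomicSentence.code] at h
    have h' := Nat.pair_eq_pair.1 (Nat.eq_of_mul_eq_mul_left two_pos h)
    rw [Encodable.encode_injective h'.1, Encodable.encode_injective h'.2]
  · simp only [AtomicSentence.code] at h; omega
  · simp only [AtomicSentence.code] at h; omega
  · simp only [AtomicSentence.code] at h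
    have h' := Nat.pair_eq_pair.1 (Nat.eq_of_mul_eq_mul_left two_pos (Nat.succ_injective h))
    have h1 := Encodable.encode_injective h'.1
    have h2 := Encodable.encode_injective h'.2
    obtain ⟨rfl, h3⟩ := Sigma.mk.inj_iff.1 h1
    obtain rfl := eq_of_heq h3
    have h4 := List.ofFn_injective h2
    have h5 : ts = ts' := funext fun i => Encodable.encode_injective (congrFun h4 i)
    rw [h5]

/-- The atomic diagram of a structure with domain `ℕ`, as a set of Gödel numbers: `2 * code φ` for
the true atomic sentences `φ`, and `2 * code φ + 1`, which stands for `¬ φ`, for the false ones. -/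
def atomicDiagram (B : L.Structure ℕ) : Set ℕ :=
  {c | ∃ φ : AtomicSentence L,
    (φ.Holds B ∧ c = 2 * φ.code) ∨ (¬ φ.Holds B ∧ c = 2 * φ.code + 1)}

/-- The arity of the symbol with number `c`, and `none` if no symbol has this number. -/
def arityOf (F : ℕ → Type u) [Encodable ((n : ℕ) × F n)] (c : ℕ) : Option ℕ :=
  (Encodable.decode₂ ((n : ℕ) × F n) c).map Sigma.fst

variable (L) in
/-- The numbering of the symbols makes `L` an `X`-computable language: one can decide with oracle
`X` whether a number is that of a function symbol (relation symbol), and compute its arity.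
Constants are function symbols of arity `0`. -/
def XComputableLanguage (X : Set ℕ) : Prop :=
  ComputableIn (oracleOf X) (arityOf L.Functions) ∧
  ComputableIn (oracleOf X) (arityOf L.Relations)

/-- The structure `A` is (up to isomorphism) `X`-computable: it has a copy with domain `ℕ` whose
atomic diagram is computable in `X`. -/
def XComputable (X : Set ℕ) (L : FirstOrder.Language.{u, v})
    [Encodable ((n : ℕ) × L.Functions n)] [Encodable ((n : ℕ) × L.Relations n)]
    (A : Type w) [L.Structure A] : Prop :=
  ∃ B : L.Structure ℕ, ComputableIn (oracleOf X) (charFun (atomicDiagram B)) ∧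
    Nonempty (ℕ ≃[L] A)

/-- The `e`-th machine with oracle `X` gives the atomic diagram of `B`: it computes the
characteristic function of the diagram. -/
def GivesDiagram (X : Set ℕ) (e : ℕ) (B : L.Structure ℕ) : Prop :=
  ∀ c, Phi X e c = Part.some (charFun (atomicDiagram B) c)

/-- The index set of `A` relative to `X`. -/
def indexSet (X : Set ℕ) (L : FirstOrder.Language.{u, v})
    [Encodable ((n : ℕ) × L.Functions n)] [Encodable ((n : ℕ) × L.Relations n)]
    (A : Type w) [L.Structure A] : Set ℕ :=
  {e | ∃ B : L.Structure ℕ, GivesDiagram X e B ∧ Nonempty (ℕ ≃[L] A)}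

end Diagram

/-! ### Self-reflective structures -/

/-- An embedding is `Σ⁰₁`-elementary if it preserves and reflects the truth of all existential
formulas. -/
def IsSigmaOneElementary {L : FirstOrder.Language.{u, v}} {N M : Type*} [L.Structure N] [L.Structure M]
    (f : N ↪[L] M) : Prop :=
  ∀ (n : ℕ) (φ : L.Formula (Fin n)), FirstOrder.Language.BoundedFormula.IsExistential φ →
    ∀ b : Fin n → N, φ.Realize (fun i => f (b i)) ↔ φ.Realize b

/-- `A` contains a proper `Σ⁰₁`-elementary substructure isomorphic to itself. (The notion is used
for finitely generated `A`.) -/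
def SelfReflective (L : FirstOrder.Language.{u, v}) (A : Type w) [L.Structure A] : Prop :=
  ∃ N : L.Substructure A, N ≠ ⊤ ∧ Nonempty (N ≃[L] A) ∧ IsSigmaOneElementary N.subtype

/-- `B` is the union of an infinite, strictly increasing chain of copies of `A`, each of them
`Σ⁰₁`-elementary in the next. -/
def IsUnionOfSigmaOneChain (L : FirstOrder.Language.{u, v}) (B : Type*) [L.Structure B]
    (A : Type w) [L.Structure A] : Prop :=
  ∃ C : ℕ → L.Substructure B,
    (∀ i, Nonempty (C i ≃[L] A)) ∧
    (∀ i, C i ≠ C (i + 1) ∧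
      ∃ h : C i ≤ C (i + 1), IsSigmaOneElementary (FirstOrder.Language.Substructure.inclusion h)) ∧
    ∀ b : B, ∃ i, b ∈ C i

end IndexSets

-- Fix a copy `S` of the structure on `ℕ` whose diagram is computable in `X`, and a finite list `a`
-- generating it.
--
-- Upper bound. An index `e` lies in the index set iff some list `b` can play the role of `a`: for
-- every `z` there is a finite partial isomorphism taking `b` to `a` and settling everything up to
-- `z` (`PartialIso`). The existence of one is enumerable in `X`, so the whole condition has the
-- form ∃∀∃. The approximations for different `z` need not cohere: each element is named by a term
-- in `b`, so its image is forced as soon as an approximation respects the naming equation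
-- (`exists_equiv_of_partialIso`).
--
-- Hardness. Self-reflection gives a `Σ⁰₁`-elementary, non-surjective `g : S → S`, and its graph is
-- enumerable because `g` is determined by its values on `a`. Membership in a `Σ⁰₃` set is recast as
-- "for some `j`, event `j` happens infinitely often". A construction by stages keeps a level, which
-- rises by one unless an event occurs at or below it, and then drops to the least such event. The
-- current list says which elements of `S` are named `0, 1, …`. To rise is to replace the names by
-- their images under `g`, so that the old copy sits inside a larger one. To drop by `m` levels is
-- to undo `g^m` on the names introduced higher up, while keeping the finite diagram already
-- promised. That such a change is possible is an existential statement with parameters in the range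
-- of `g^m`, so elementarity provides it (`StackInv.exists_step`). If some event recurs, the level
-- has a finite limit inferior and the limit is a copy of `S`. Otherwise the levels tend to
-- infinity, and the limit is a direct limit along positive iterates of `g`: a strictly increasing
-- chain, hence not finitely generated.
--
-- Effectivity is handled through `REIn`, which is closed under conjunction, disjunction,
-- existential and bounded universal quantifiers, and inductive definitions.
-- `REIn.exists_uniformization` makes the choices of the construction, and
-- `exists_computable_Phi_eq` turns an enumerable graph into programs uniformly.

attribute [fun_prop] Primrec PrimrecPred

namespace IndexSets

/-! ### Closure properties of primitive recursion, in the form used for automation -/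

section Primrec

variable {α β γ : Type*} [Primcodable α] [Primcodable β] [Primcodable γ]

@[fun_prop]
theorem primrec_id' : Primrec fun a : α => a := Primrec.id

@[fun_prop]
theorem primrec_const' (b : β) : Primrec fun _ : α => b := Primrec.const b

@[fun_prop]
theorem primrec_comp' {f : β → γ} {g : α → β} (hf : Primrec f) (hg : Primrec g) :
    Primrec fun a => f (g a) := hf.comp hg

@[fun_prop]
theorem primrec_fst {f : α → β × γ} (hf : Primrec f) : Primrec fun a => (f a).1 :=
  Primrec.fst.comp hf

@[fun_prop]
theorem primrec_snd {f : α → β × γ} (hf : Primrec f) : Primrec fun a => (f a).2 :=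
  Primrec.snd.comp hf

@[fun_prop]
theorem primrec_prodMk {f : α → β} {g : α → γ} (hf : Primrec f) (hg : Primrec g) :
    Primrec fun a => (f a, g a) := hf.pair hg

@[fun_prop]
theorem primrec_add {f g : α → ℕ} (hf : Primrec f) (hg : Primrec g) :
    Primrec fun a => f a + g a := Primrec.nat_add.comp hf hg

@[fun_prop]
theorem primrec_sub {f g : α → ℕ} (hf : Primrec f) (hg : Primrec g) :
    Primrec fun a => f a - g a := Primrec.nat_sub.comp hf hg

@[fun_prop]
theorem primrec_mul {f g : α → ℕ} (hf : Primrec f) (hg : Primrec g) :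
    Primrec fun a => f a * g a := Primrec.nat_mul.comp hf hg

@[fun_prop]
theorem primrec_div {f g : α → ℕ} (hf : Primrec f) (hg : Primrec g) :
    Primrec fun a => f a / g a := Primrec.nat_div.comp hf hg

@[fun_prop]
theorem primrec_mod {f g : α → ℕ} (hf : Primrec f) (hg : Primrec g) :
    Primrec fun a => f a % g a := Primrec.nat_mod.comp hf hg

@[fun_prop]
theorem primrec_natPair {f g : α → ℕ} (hf : Primrec f) (hg : Primrec g) :
    Primrec fun a => Nat.pair (f a) (g a) := Primrec₂.natPair.comp hf hg

@[fun_prop]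
theorem primrec_unpair {f : α → ℕ} (hf : Primrec f) :
    Primrec fun a => Nat.unpair (f a) := Primrec.unpair.comp hf

@[fun_prop]
theorem primrec_encode {f : α → β} (hf : Primrec f) :
    Primrec fun a => Encodable.encode (f a) := Primrec.encode.comp hf

@[fun_prop]
theorem primrec_decode {f : α → ℕ} (hf : Primrec f) :
    Primrec fun a => (Encodable.decode (f a) : Option β) := Primrec.decode.comp hf

@[fun_prop]
theorem primrec_ofNat {β : Type*} [Denumerable β] {f : α → ℕ} (hf : Primrec f) :
    Primrec fun a => Denumerable.ofNat β (f a) := (Primrec.ofNat β).comp hf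

@[fun_prop]
theorem primrec_some {f : α → β} (hf : Primrec f) : Primrec fun a => some (f a) :=
  Primrec.option_some.comp hf

@[fun_prop]
theorem primrec_optionToList {f : α → Option β} (hf : Primrec f) :
    Primrec fun a => (f a).toList := Primrec.optionToList.comp hf

@[fun_prop]
theorem primrec_cons {f : α → β} {g : α → List β} (hf : Primrec f) (hg : Primrec g) :
    Primrec fun a => f a :: g a := Primrec.list_cons.comp hf hg

@[fun_prop]
theorem primrec_append {f g : α → List β} (hf : Primrec f) (hg : Primrec g) :
    Primrec fun a => f a ++ g a := Primrec.list_append.comp hf hg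

@[fun_prop]
theorem primrec_listMap {f : α → List β} {g : α → β → γ} (hf : Primrec f)
    (hg : Primrec fun p : α × β => g p.1 p.2) : Primrec fun a => (f a).map (g a) :=
  Primrec.list_map hf hg

@[fun_prop]
theorem primrec_flatMap {f : α → List β} {g : α → β → List γ} (hf : Primrec f)
    (hg : Primrec fun p : α × β => g p.1 p.2) : Primrec fun a => (f a).flatMap (g a) :=
  Primrec.list_flatMap hf hg

@[fun_prop]
theorem primrec_length {f : α → List β} (hf : Primrec f) : Primrec fun a => (f a).length :=
  Primrec.list_length.comp hf

@[fun_prop]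
theorem primrec_range {f : α → ℕ} (hf : Primrec f) : Primrec fun a => List.range (f a) :=
  Primrec.list_range.comp hf

@[fun_prop]
theorem primrec_drop {f : α → ℕ} {g : α → List β} (hf : Primrec f) (hg : Primrec g) :
    Primrec fun a => (g a).drop (f a) := Primrec.list_drop.comp hf hg

@[fun_prop]
theorem primrec_take {f : α → ℕ} {g : α → List β} (hf : Primrec f) (hg : Primrec g) :
    Primrec fun a => (g a).take (f a) := Primrec.list_take.comp hf hg

@[fun_prop]
theorem primrec_getElem? {f : α → ℕ} {g : α → List β} (hf : Primrec f) (hg : Primrec g) :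
    Primrec fun a => (g a)[f a]? := Primrec.list_getElem?.comp hg hf

@[fun_prop]
theorem primrec_getD {d : β} {f : α → ℕ} {g : α → List β} (hf : Primrec f) (hg : Primrec g) :
    Primrec fun a => (g a).getD (f a) d := (Primrec.list_getD d).comp hg hf

@[fun_prop]
theorem primrec_ite {c : α → Prop} [DecidablePred c] {f g : α → β} (hc : PrimrecPred c)
    (hf : Primrec f) (hg : Primrec g) : Primrec fun a => if c a then f a else g a :=
  Primrec.ite hc hf hg

@[fun_prop]
theorem primrecPred_eq {f g : α → β} (hf : Primrec f) (hg : Primrec g) :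
    PrimrecPred fun a => f a = g a := Primrec.eq.comp hf hg

@[fun_prop]
theorem primrecPred_le {f g : α → ℕ} (hf : Primrec f) (hg : Primrec g) :
    PrimrecPred fun a => f a ≤ g a := Primrec.nat_le.comp hf hg

@[fun_prop]
theorem primrecPred_lt {f g : α → ℕ} (hf : Primrec f) (hg : Primrec g) :
    PrimrecPred fun a => f a < g a := Primrec.nat_lt.comp hf hg

@[fun_prop]
theorem primrecPred_and {p q : α → Prop} (hp : PrimrecPred p) (hq : PrimrecPred q) :
    PrimrecPred fun a => p a ∧ q a := hp.and hq

@[fun_prop]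
theorem primrecPred_or {p q : α → Prop} (hp : PrimrecPred p) (hq : PrimrecPred q) :
    PrimrecPred fun a => p a ∨ q a := hp.or hq

@[fun_prop]
theorem primrecPred_not {p : α → Prop} (hp : PrimrecPred p) :
    PrimrecPred fun a => ¬ p a := hp.not

@[fun_prop]
theorem primrecPred_comp {p : β → Prop} {f : α → β} (hp : PrimrecPred p) (hf : Primrec f) :
    PrimrecPred fun a => p (f a) := hp.comp hf

theorem primrecPred_exists_mem {f : α → List β} {p : α → β → Prop} (hf : Primrec f)
    (hp : PrimrecPred fun q : α × β => p q.1 q.2) : PrimrecPred fun a => ∃ b ∈ f a, p a b := by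
  have h : PrimrecRel fun (b : β) (a : α) => p a b :=
    PrimrecPred.comp hp (Primrec.pair Primrec.snd Primrec.fst)
  exact h.exists_mem_list.comp hf Primrec.id

theorem primrecPred_forall_mem {f : α → List β} {p : α → β → Prop} (hf : Primrec f)
    (hp : PrimrecPred fun q : α × β => p q.1 q.2) : PrimrecPred fun a => ∀ b ∈ f a, p a b := by
  have h : PrimrecRel fun (b : β) (a : α) => p a b :=
    PrimrecPred.comp hp (Primrec.pair Primrec.snd Primrec.fst)
  exact h.forall_mem_list.comp hf Primrec.id

@[fun_prop]
theorem primrecPred_mem {f : α → β} {g : α → List β} (hf : Primrec f) (hg : Primrec g) :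
    PrimrecPred fun a => f a ∈ g a :=
  (primrecPred_exists_mem (p := fun a b => b = f a) hg (by fun_prop)).of_eq fun a => by simp

@[fun_prop]
theorem primrecPred_prefix {f g : α → List β} (hf : Primrec f) (hg : Primrec g) :
    PrimrecPred fun a => f a <+: g a :=
  (primrecPred_forall_mem (f := fun a => List.range (f a).length)
    (p := fun a i => (f a)[i]? = (g a)[i]?) (by fun_prop) (by fun_prop)).of_eq fun a => by
    rw [List.prefix_iff_getElem?]
    constructor
    · intro h i hi
      rw [← h i (List.mem_range.2 hi), List.getElem?_eq_getElem hi]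
    · intro h i hi
      rw [h i (List.mem_range.1 hi), List.getElem?_eq_getElem]

-- Only bounded quantifiers over positions remain on the right, which makes primitive recursiveness
-- visible.
omit [Primcodable β] in
theorem nodup_iff_getElem? (l : List β) :
    l.Nodup ↔ ∀ i ∈ List.range l.length, ∀ j ∈ List.range l.length, l[i]? = l[j]? → i = j := by
  constructor
  · intro h i hi j _ hij
    exact (List.getElem?_inj (List.mem_range.1 hi) h).1 hij
  · intro h
    rw [List.nodup_iff_injective_get]
    intro i j hij
    refine Fin.ext (h i (List.mem_range.2 i.2) j (List.mem_range.2 j.2) ?_)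
    simpa using hij

@[fun_prop]
theorem primrecPred_nodup {f : α → List β} (hf : Primrec f) :
    PrimrecPred fun a => (f a).Nodup :=
  (primrecPred_forall_mem (f := fun a => List.range (f a).length)
    (p := fun a i => ∀ j ∈ List.range (f a).length, ¬ (f a)[i]? = (f a)[j]? ∨ i = j)
    (by fun_prop) (primrecPred_forall_mem (by fun_prop) (by fun_prop))).of_eq fun a => by
      rw [nodup_iff_getElem?]
      simp only [imp_iff_not_or]

end Primrec

/-! ### Predicates that are recursively enumerable relative to an oracle -/

/-- The list `σ` of pairs of a query and its answer is correct for the oracle `X`. -/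
def CorrectFor (X : Set ℕ) (σ : List (ℕ × ℕ)) : Prop :=
  ∀ q ∈ σ, charFun X q.1 = q.2

theorem correctFor_append {X : Set ℕ} {σ τ : List (ℕ × ℕ)} :
    CorrectFor X (σ ++ τ) ↔ CorrectFor X σ ∧ CorrectFor X τ := by
  simp [CorrectFor, List.mem_append, or_imp, forall_and]

theorem correctFor_flatMap {X : Set ℕ} {β : Type*} {l : List β} {f : β → List (ℕ × ℕ)} :
    CorrectFor X (l.flatMap f) ↔ ∀ b ∈ l, CorrectFor X (f b) := by
  simp only [CorrectFor, List.mem_flatMap]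
  exact ⟨fun h b hb q hq => h q ⟨b, hb, hq⟩, fun h q ⟨b, hb, hq⟩ => h b hb q hq⟩

/-- The predicate `p` is recursively enumerable in `X`: it is decided positively by a primitive
recursive search that has access to finitely many correct answers of the oracle. -/
@[fun_prop]
def REIn (X : Set ℕ) {α : Type*} [Primcodable α] (p : α → Prop) : Prop :=
  ∃ r : α × ℕ × List (ℕ × ℕ) → Prop, PrimrecPred r ∧
    ∀ a, p a ↔ ∃ w σ, r (a, w, σ) ∧ CorrectFor X σ

namespace REIn

variable {X : Set ℕ} {α β γ : Type*} [Primcodable α] [Primcodable β] [Primcodable γ]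

/-- Witnesses may be taken from any coded type: the number `w` is decoded, and `toList` makes
failure to decode an empty bounded search. -/
theorem of_witness {p : α → Prop} {r : α × β × List (ℕ × ℕ) → Prop} (hr : PrimrecPred r)
    (h : ∀ a, p a ↔ ∃ b σ, r (a, b, σ) ∧ CorrectFor X σ) : REIn X p := by
  refine ⟨fun x => ∃ b ∈ (Encodable.decode (α := β) x.2.1).toList, r (x.1, b, x.2.2),
    primrecPred_exists_mem (by fun_prop) (primrecPred_comp hr (by fun_prop)), fun a => ?_⟩
  rw [h]
  constructor
  · rintro ⟨b, σ, hr, hσ⟩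
    exact ⟨Encodable.encode b, σ, ⟨b, by simp, hr⟩, hσ⟩
  · rintro ⟨w, σ, ⟨b, -, hr⟩, hσ⟩
    exact ⟨b, σ, hr, hσ⟩

theorem of_eq {p q : α → Prop} (hp : REIn X p) (h : ∀ a, p a ↔ q a) : REIn X q :=
  (funext fun a => propext (h a) : p = q) ▸ hp

theorem of_primrecPred {p : α → Prop} (hp : PrimrecPred p) : REIn X p :=
  of_witness (β := ℕ) (r := fun x => p x.1) (by fun_prop) fun a =>
    ⟨fun h => ⟨0, [], h, by simp [CorrectFor]⟩, fun ⟨_, _, h, _⟩ => h⟩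

@[fun_prop]
theorem comp {p : β → Prop} {f : α → β} (hp : REIn X p) (hf : Primrec f) :
    REIn X fun a => p (f a) := by
  obtain ⟨r, hr, h⟩ := hp
  exact ⟨fun x => r (f x.1, x.2), by fun_prop, fun a => h (f a)⟩

-- Both searches are run, and the list of oracle answers is the concatenation of their lists; it is
-- correct iff both parts are.
@[fun_prop]
theorem and {p q : α → Prop} (hp : REIn X p) (hq : REIn X q) : REIn X fun a => p a ∧ q a := by
  obtain ⟨r, hr, h⟩ := hp
  obtain ⟨r', hr', h'⟩ := hq
  refine of_witness (β := (ℕ × List (ℕ × ℕ)) × (ℕ × List (ℕ × ℕ)))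
    (r := fun x => r (x.1, x.2.1.1) ∧ r' (x.1, x.2.1.2) ∧ x.2.2 = x.2.1.1.2 ++ x.2.1.2.2)
    (by fun_prop) fun a => ?_
  rw [h, h']
  constructor
  · rintro ⟨⟨w, σ, h1, h2⟩, ⟨w', σ', h1', h2'⟩⟩
    exact ⟨((w, σ), (w', σ')), _, ⟨h1, h1', rfl⟩, correctFor_append.2 ⟨h2, h2'⟩⟩
  · rintro ⟨⟨⟨w, σ⟩, ⟨w', σ'⟩⟩, τ, ⟨h1, h1', h3⟩, h2⟩
    simp only at h3
    rw [h3, correctFor_append] at h2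
    exact ⟨⟨w, σ, h1, h2.1⟩, ⟨w', σ', h1', h2.2⟩⟩

@[fun_prop]
theorem or {p q : α → Prop} (hp : REIn X p) (hq : REIn X q) : REIn X fun a => p a ∨ q a := by
  obtain ⟨r, hr, h⟩ := hp
  obtain ⟨r', hr', h'⟩ := hq
  refine ⟨fun x => r x ∨ r' x, by fun_prop, fun a => ?_⟩
  simp only [h, h', or_and_right, exists_or]

@[fun_prop]
theorem exists' {p : α → β → Prop} (hp : REIn X fun x : α × β => p x.1 x.2) :
    REIn X fun a => ∃ b, p a b := by
  obtain ⟨r, hr, h⟩ := hp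
  refine of_witness (β := β × ℕ) (r := fun x => r ((x.1, x.2.1.1), x.2.1.2, x.2.2))
    (by fun_prop) fun a => ?_
  constructor
  · rintro ⟨b, hb⟩
    obtain ⟨w, σ, h1, h2⟩ := (h (a, b)).1 hb
    exact ⟨(b, w), σ, h1, h2⟩
  · rintro ⟨⟨b, w⟩, σ, h1, h2⟩
    exact ⟨b, (h (a, b)).2 ⟨w, σ, h1, h2⟩⟩

/-- A single witness collects one search witness for each member of the list, together with all the
oracle answers used. -/
theorem forall_mem {l : α → List β} {p : α → β → Prop} (hl : Primrec l)
    (hp : REIn X fun x : α × β => p x.1 x.2) : REIn X fun a => ∀ b ∈ l a, p a b := by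
  obtain ⟨r, hr, h⟩ := hp
  refine of_witness (β := List (β × ℕ × List (ℕ × ℕ)))
    (r := fun x => x.2.1.map Prod.fst = l x.1 ∧ (∀ t ∈ x.2.1, r ((x.1, t.1), t.2)) ∧
      x.2.2 = x.2.1.flatMap fun t => t.2.2) ?_ fun a => ?_
  · refine primrecPred_and (by fun_prop) (primrecPred_and
      (primrecPred_forall_mem (by fun_prop) (by fun_prop)) (by fun_prop))
  · constructor
    · intro H
      have : ∀ l' : List β, (∀ b ∈ l', p a b) → ∃ L : List (β × ℕ × List (ℕ × ℕ)),
          L.map Prod.fst = l' ∧ ∀ t ∈ L, r ((a, t.1), t.2) ∧ CorrectFor X t.2.2 := by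
        intro l' hl'
        induction l' with
        | nil => exact ⟨[], by simp⟩
        | cons b l' ih =>
          obtain ⟨L, h1, h2⟩ := ih fun b hb => hl' b (by simp [hb])
          obtain ⟨w, σ, h3, h4⟩ := (h (a, b)).1 (hl' b (by simp))
          exact ⟨(b, w, σ) :: L, by simp [h1], by simpa [h3, h4] using fun a b c => h2 (a, b, c)⟩
      obtain ⟨L, h1, h2⟩ := this _ H
      exact ⟨L, _, ⟨h1, fun t ht => (h2 t ht).1, rfl⟩,
        correctFor_flatMap.2 fun t ht => (h2 t ht).2⟩
    · rintro ⟨L, σ, ⟨h1, h2, h3⟩, h4⟩ b hb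
      simp only at h1 h2 h3
      rw [h3, correctFor_flatMap] at h4
      rw [← h1, List.mem_map] at hb
      obtain ⟨t, ht, rfl⟩ := hb
      exact (h (a, t.1)).2 ⟨t.2.1, t.2.2, h2 t ht, h4 t ht⟩

theorem forall_lt {n : α → ℕ} {p : α → ℕ → Prop} (hn : Primrec n)
    (hp : REIn X fun x : α × ℕ => p x.1 x.2) : REIn X fun a => ∀ i < n a, p a i :=
  (forall_mem (l := fun a => List.range (n a)) (by fun_prop) hp).of_eq fun a => by simp

@[fun_prop]
theorem eq {f g : α → β} (hf : Primrec f) (hg : Primrec g) : REIn X fun a => f a = g a :=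
  of_primrecPred (by fun_prop)

@[fun_prop]
theorem ne {f g : α → β} (hf : Primrec f) (hg : Primrec g) : REIn X fun a => f a ≠ g a :=
  of_primrecPred (by unfold Ne; fun_prop)

@[fun_prop]
theorem le {f g : α → ℕ} (hf : Primrec f) (hg : Primrec g) : REIn X fun a => f a ≤ g a :=
  of_primrecPred (by fun_prop)

@[fun_prop]
theorem lt {f g : α → ℕ} (hf : Primrec f) (hg : Primrec g) : REIn X fun a => f a < g a :=
  of_primrecPred (by fun_prop)

@[fun_prop]
theorem mem {f : α → β} {g : α → List β} (hf : Primrec f) (hg : Primrec g) :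
    REIn X fun a => f a ∈ g a :=
  of_primrecPred (by fun_prop)

@[fun_prop]
theorem prefix' {f g : α → List β} (hf : Primrec f) (hg : Primrec g) :
    REIn X fun a => f a <+: g a :=
  of_primrecPred (by fun_prop)

@[fun_prop]
theorem nodup {f : α → List β} (hf : Primrec f) : REIn X fun a => (f a).Nodup :=
  of_primrecPred (by fun_prop)

@[fun_prop]
theorem charFun_eq {f g : α → ℕ} (hf : Primrec f) (hg : Primrec g) :
    REIn X fun a => charFun X (f a) = g a :=
  of_witness (β := ℕ) (r := fun x => x.2.2 = [(f x.1, g x.1)]) (by fun_prop) fun a => by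
    simp [CorrectFor]

/-- A wrong answer is refuted by exhibiting the right one, which is itself a single oracle answer.
-/
theorem not_correctFor : REIn X fun σ : List (ℕ × ℕ) => ¬ CorrectFor X σ :=
  (of_witness (β := ℕ) (r := fun x => ∃ q ∈ x.1, q.2 ≠ x.2.1 ∧ x.2.2 = [(q.1, x.2.1)])
    (primrecPred_exists_mem (by fun_prop) (by unfold Ne; fun_prop)) fun σ => by
      simp only [CorrectFor, not_forall]
      constructor
      · rintro ⟨q, hq, hne⟩
        exact ⟨charFun X q.1, [(q.1, charFun X q.1)], ⟨q, hq, Ne.symm hne, rfl⟩, by simp⟩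
      · rintro ⟨w, _, ⟨q, hq, hne, rfl⟩, h⟩
        refine ⟨q, hq, ?_⟩
        rw [h (q.1, w) (by simp)]
        exact hne.symm)

/-- Among the values related to an argument by a recursively enumerable relation, one can be
selected in a recursively enumerable way. -/
theorem exists_uniformization {p : α × β → Prop} (hp : REIn X p) :
    ∃ q : α × β → Prop, REIn X q ∧ (∀ x, q x → p x) ∧
      (∀ a b b', q (a, b) → q (a, b') → b = b') ∧ ∀ a, (∃ b, p (a, b)) → ∃ b, q (a, b) := by
  obtain ⟨r, hr, h⟩ := hp
  -- The selected value is the one in the least code `n` of a verified triple. That all smaller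
  -- codes fail is enumerable too, since oracle answers can be refuted as well as confirmed.
  let good (a : α) (n : ℕ) (t : β × ℕ × List (ℕ × ℕ)) : Prop :=
    t ∈ (Encodable.decode (α := β × ℕ × List (ℕ × ℕ)) n).toList ∧ r ((a, t.1), t.2) ∧ CorrectFor X t.2.2
  have hgood : REIn X fun y : (α × ℕ) × (β × ℕ × List (ℕ × ℕ)) => good y.1.1 y.1.2 y.2 := by
    have h1 : REIn X fun y : (α × ℕ) × (β × ℕ × List (ℕ × ℕ)) => CorrectFor X y.2.2.2 :=
      of_witness (β := ℕ) (r := fun y => y.2.2 = y.1.2.2.2) (by fun_prop) fun a => by simp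
    exact and (by fun_prop) (and (of_primrecPred (by fun_prop)) h1)
  have hbad : REIn X fun y : α × ℕ => ∀ t ∈ (Encodable.decode (α := β × ℕ × List (ℕ × ℕ)) y.2).toList,
      ¬ r ((y.1, t.1), t.2) ∨ ¬ CorrectFor X t.2.2 :=
    forall_mem (by fun_prop) (or (of_primrecPred (by fun_prop))
      (not_correctFor.comp (f := fun y : (α × ℕ) × (β × ℕ × List (ℕ × ℕ)) => y.2.2.2) (by fun_prop)))
  have hbad' (a : α) (n : ℕ) : (∀ t ∈ (Encodable.decode (α := β × ℕ × List (ℕ × ℕ)) n).toList,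
      ¬ r ((a, t.1), t.2) ∨ ¬ CorrectFor X t.2.2) ↔ ¬ ∃ t, good a n t := by
    simp only [good]
    grind
  refine ⟨fun x => ∃ n, (∃ t, good x.1 n t ∧ t.1 = x.2) ∧ ∀ m < n,
    ∀ t ∈ (Encodable.decode (α := β × ℕ × List (ℕ × ℕ)) m).toList, ¬ r ((x.1, t.1), t.2) ∨ ¬ CorrectFor X t.2.2,
    ?_, ?_, ?_, ?_⟩
  · refine exists' (and (exists' (and ?_ (by fun_prop))) (forall_lt (by fun_prop) ?_))
    · exact hgood.comp (f := fun y : ((α × β) × ℕ) × (β × ℕ × List (ℕ × ℕ)) => ((y.1.1.1, y.1.2), y.2)) (by fun_prop)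
    · exact hbad.comp (f := fun y : ((α × β) × ℕ) × ℕ => (y.1.1.1, y.2)) (by fun_prop)
  · rintro ⟨a, b⟩ ⟨n, ⟨t, ⟨-, h1, h2⟩, rfl⟩, -⟩
    exact (h _).2 ⟨_, _, h1, h2⟩
  · rintro a b b' ⟨n, ⟨t, ht, rfl⟩, hn⟩ ⟨n', ⟨t', ht', rfl⟩, hn'⟩
    simp only [hbad'] at hn hn' ht ht'
    have : n = n' := by
      rcases lt_trichotomy n n' with hlt | heq | hlt
      · exact absurd ⟨t, ht⟩ (hn' _ hlt)
      · exact heq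
      · exact absurd ⟨t', ht'⟩ (hn _ hlt)
    subst this
    have h1 := ht.1
    have h2 := ht'.1
    simp only [Option.mem_toList] at h1 h2
    rw [h1] at h2
    rw [Option.some_injective _ h2]
  · rintro a ⟨b, hb⟩
    obtain ⟨w, σ, h1, h2⟩ := (h _).1 hb
    have hex : ∃ n, ∃ t, good a n t :=
      ⟨Encodable.encode (b, w, σ), (b, w, σ), by simp only [Encodable.encodek]; simp, h1, h2⟩
    classical
    obtain ⟨t, ht⟩ := Nat.find_spec hex
    refine ⟨t.1, Nat.find hex, ⟨t, ht, rfl⟩, fun m hm => ?_⟩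
    rw [hbad']
    exact Nat.find_min hex hm

end REIn

end IndexSets

namespace IndexSets

variable {X : Set ℕ}

/-! ### Inductive definitions by enumerable rules -/

section Derivable

variable {α : Type*}

/-- The least predicate closed under the rules `J`, where `J a L` says that `a` may be inferred
from the members of `L`. -/
inductive Derivable (J : α → List α → Prop) : α → Prop
  | intro {a : α} (L : List α) (h : J a L) (hL : ∀ b ∈ L, Derivable J b) : Derivable J a

/-- Every entry of the list `D` is inferred by a rule from later entries. -/
def IsDerivation (J : α → List α → Prop) (D : List α) : Prop :=
  ∀ i < D.length, ∃ x L, D[i]? = some x ∧ (∀ b ∈ L, b ∈ D.drop (i + 1)) ∧ J x L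

theorem isDerivation_cons {J : α → List α → Prop} {a : α} {D : List α} :
    IsDerivation J (a :: D) ↔ (∃ L, (∀ b ∈ L, b ∈ D) ∧ J a L) ∧ IsDerivation J D := by
  constructor
  · refine fun h => ⟨?_, fun i hi => ?_⟩
    · obtain ⟨x, L, h1, h2, h3⟩ := h 0 (by simp)
      simp only [List.getElem?_cons_zero, Option.some.injEq] at h1
      subst h1
      exact ⟨L, by simpa using h2, h3⟩
    · obtain ⟨x, L, h1, h2, h3⟩ := h (i + 1) (by simpa using hi)
      exact ⟨x, L, by simpa using h1, by simpa using h2, h3⟩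
  · rintro ⟨⟨L, h1, h2⟩, h⟩ i hi
    cases i with
    | zero => exact ⟨a, L, by simp, by simpa using h1, h2⟩
    | succ i =>
      obtain ⟨x, L, h1, h2, h3⟩ := h i (by simpa using hi)
      exact ⟨x, L, by simpa using h1, by simpa using h2, h3⟩

theorem IsDerivation.append {J : α → List α → Prop} {D E : List α} (hD : IsDerivation J D)
    (hE : IsDerivation J E) : IsDerivation J (D ++ E) := by
  induction D with
  | nil => exact hE
  | cons a D ih =>
    rw [isDerivation_cons] at hD
    rw [List.cons_append, isDerivation_cons]
    obtain ⟨⟨L, h1, h2⟩, h⟩ := hD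
    exact ⟨⟨L, fun b hb => List.mem_append_left _ (h1 b hb), h2⟩, ih h⟩

theorem IsDerivation.derivable {J : α → List α → Prop} {D : List α} (hD : IsDerivation J D) :
    ∀ a ∈ D, Derivable J a := by
  induction D with
  | nil => simp
  | cons a D ih =>
    rw [isDerivation_cons] at hD
    obtain ⟨⟨L, h1, h2⟩, h⟩ := hD
    rw [List.forall_mem_cons]
    exact ⟨.intro L h2 fun b hb => ih h b (h1 b hb), ih h⟩

/-- Derivations of the finitely many premises are concatenated; a derivation only asks that premises
come later, so the result is again one. -/
theorem Derivable.exists_isDerivation {J : α → List α → Prop} {a : α} (h : Derivable J a) :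
    ∃ D, IsDerivation J (a :: D) := by
  induction h with
  | @intro a L h _ ih =>
    have : ∀ L' : List α, (∀ b ∈ L', ∃ D, IsDerivation J (b :: D)) →
        ∃ D, IsDerivation J D ∧ ∀ b ∈ L', b ∈ D := by
      intro L' hL'
      induction L' with
      | nil => exact ⟨[], by simp [IsDerivation]⟩
      | cons b L' ih' =>
        obtain ⟨D, h1, h2⟩ := ih' fun c hc => hL' c (by simp [hc])
        obtain ⟨E, h3⟩ := hL' b (by simp)
        refine ⟨(b :: E) ++ D, h3.append h1, ?_⟩
        rw [List.forall_mem_cons]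
        exact ⟨by simp, fun c hc => List.mem_append_right _ (h2 c hc)⟩
    obtain ⟨D, h1, h2⟩ := this L ih
    exact ⟨D, isDerivation_cons.2 ⟨⟨L, h2, h⟩, h1⟩⟩

/-- A predicate that is inductively defined by recursively enumerable rules is recursively
enumerable. -/
theorem REIn.derivable [Primcodable α] {J : α → List α → Prop}
    (hJ : REIn X fun x : α × List α => J x.1 x.2) : REIn X (Derivable J) := by
  have h1 : REIn X fun x : (((α × List α) × ℕ) × α) × List α => J x.1.2 x.2 :=
    hJ.comp (f := fun x : (((α × List α) × ℕ) × α) × List α => (x.1.2, x.2)) (by fun_prop)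
  have h2 : REIn X fun x : (((α × List α) × ℕ) × α) × List α =>
      ∀ b ∈ x.2, b ∈ (x.1.1.1.1 :: x.1.1.1.2).drop (x.1.1.2 + 1) :=
    REIn.forall_mem (by fun_prop) (by fun_prop)
  have h3 : REIn X fun x : α × List α => IsDerivation J (x.1 :: x.2) :=
    REIn.forall_lt (by fun_prop) (by fun_prop)
  refine h3.exists'.of_eq fun a => ⟨?_, Derivable.exists_isDerivation⟩
  rintro ⟨D, hD⟩
  exact hD.derivable a (by simp)

end Derivable

/-! ### The universal machine -/

namespace OracleCode

/-- The rules that generate the triples of a program, an argument and the value there. -/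
def EvalRule (X : Set ℕ) (x : ℕ × ℕ × ℕ) (L : List (ℕ × ℕ × ℕ)) : Prop :=
  (x.1 = 0 ∧ x.2.2 = 0) ∨ (x.1 = 1 ∧ x.2.2 = x.2.1 + 1) ∨
  (x.1 = 2 ∧ x.2.2 = (Nat.unpair x.2.1).1) ∨ (x.1 = 3 ∧ x.2.2 = (Nat.unpair x.2.1).2) ∨
  (x.1 = 4 ∧ charFun X x.2.1 = x.2.2) ∨
  (∃ a b y z, x.1 = 2 * (2 * Nat.pair a b) + 5 ∧ x.2.2 = Nat.pair y z ∧ (a, x.2.1, y) ∈ L ∧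
    (b, x.2.1, z) ∈ L) ∨
  (∃ a b y, x.1 = 2 * (2 * Nat.pair a b + 1) + 5 ∧ (b, x.2.1, y) ∈ L ∧ (a, y, x.2.2) ∈ L) ∨
  (∃ a b c, x.1 = (2 * (2 * Nat.pair a b) + 1) + 5 ∧ x.2.1 = Nat.pair c 0 ∧
    (a, c, x.2.2) ∈ L) ∨
  (∃ a b c n y, x.1 = (2 * (2 * Nat.pair a b) + 1) + 5 ∧ x.2.1 = Nat.pair c (n + 1) ∧
    (x.1, Nat.pair c n, y) ∈ L ∧ (b, Nat.pair c (Nat.pair n y), x.2.2) ∈ L) ∨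
  (∃ a c m n, x.1 = (2 * (2 * a + 1) + 1) + 5 ∧ x.2.1 = Nat.pair c m ∧ x.2.2 = n + m ∧
    (a, Nat.pair c (n + m), 0) ∈ L ∧
    ∀ k < n, ∃ y, y ≠ 0 ∧ (a, Nat.pair c (k + m), y) ∈ L)

theorem reIn_evalRule :
    REIn X fun x : (ℕ × ℕ × ℕ) × List (ℕ × ℕ × ℕ) => EvalRule X x.1 x.2 := by
  unfold EvalRule
  refine .or (by fun_prop) (.or (by fun_prop) (.or (by fun_prop) (.or (by fun_prop)
    (.or (by fun_prop) (.or (by fun_prop) (.or (by fun_prop) (.or (by fun_prop)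
    (.or (by fun_prop) ?_))))))))
  refine .exists' (.exists' (.exists' (.exists' (.and (by fun_prop) (.and (by fun_prop)
    (.and (by fun_prop) (.and (by fun_prop) (REIn.forall_lt (by fun_prop) (by fun_prop)))))))))

/-- Soundness of the rules, by induction on derivations; in each case the number of the program
determines its outermost constructor. -/
theorem mem_eval_of_derivable {x : ℕ × ℕ × ℕ} (h : Derivable (EvalRule X) x) :
    x.2.2 ∈ (ofNatCode x.1).eval (charFun X) x.2.1 := by
  induction h with
  | @intro x L h _ ih =>
    obtain ⟨e, c, v⟩ := x
    have enc : ∀ C : OracleCode, e = encodeCode C → ofNatCode e = C := by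
      rintro C rfl
      exact ofNatCode_encodeCode C
    simp only [EvalRule] at h ⊢
    obtain ⟨rfl, rfl⟩ | ⟨rfl, rfl⟩ | ⟨rfl, rfl⟩ | ⟨rfl, rfl⟩ | ⟨rfl, rfl⟩ | h | h | h | h | h := h
    · simp [ofNatCode, eval]
    · simp [ofNatCode, eval]
    · simp [ofNatCode, eval]
    · simp [ofNatCode, eval]
    · simp [ofNatCode, eval]
    · obtain ⟨a, b, y, z, h1, h2, h3, h4⟩ := h
      rw [enc (.pair (ofNatCode a) (ofNatCode b)) (by simp [encodeCode, encodeCode_ofNatCode, h1])]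
      have h3 := ih _ h3
      have h4 := ih _ h4
      simp only at h3 h4
      simp only [eval, Part.map_eq_map, Seq.seq, Part.mem_bind_iff,
        Part.mem_map_iff, exists_exists_and_eq_and]
      exact ⟨y, h3, z, h4, h2.symm⟩
    · obtain ⟨a, b, y, h1, h2, h3⟩ := h
      rw [enc (.comp (ofNatCode a) (ofNatCode b)) (by simp [encodeCode, encodeCode_ofNatCode, h1])]
      exact Part.mem_bind (ih _ h2) (ih _ h3)
    · obtain ⟨a, b, c, h1, h2, h3⟩ := h
      rw [enc (.prec (ofNatCode a) (ofNatCode b)) (by simp [encodeCode, encodeCode_ofNatCode, h1])]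
      have h3 := ih _ h3
      simpa [eval, h2, Nat.unpaired] using h3
    · obtain ⟨a, b, c, n, y, h1, h2, h3, h4⟩ := h
      have h3 := ih _ h3
      have h4 := ih _ h4
      rw [enc (.prec (ofNatCode a) (ofNatCode b))
        (by simp [encodeCode, encodeCode_ofNatCode, h1])] at h3 ⊢
      simp only [eval, h2, Nat.unpaired, Nat.unpair_pair] at h3 ⊢
      exact Part.mem_bind h3 h4
    · obtain ⟨a, c, m, n, h1, h2, h3, h4, h5⟩ := h
      have h4 := ih _ h4
      rw [enc (.rfind' (ofNatCode a)) (by simp [encodeCode, encodeCode_ofNatCode, h1])]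
      simp only [eval, h2, Nat.unpaired, Nat.unpair_pair, h3]
      refine Part.mem_map (· + m) (Nat.mem_rfind.2 ⟨?_, fun {k} hk => ?_⟩)
      · exact (Part.mem_map_iff _).2 ⟨0, h4, by simp⟩
      · obtain ⟨y, hy, h6⟩ := h5 k hk
        exact (Part.mem_map_iff _).2 ⟨y, ih _ h6, by simp [hy]⟩

/-- Completeness of the rules, by induction on the program, with an inner induction on the recursion
variable for `prec`. -/
theorem derivable_of_mem_eval (C : OracleCode) (c v : ℕ) (h : v ∈ C.eval (charFun X) c) :
    Derivable (EvalRule X) (encodeCode C, c, v) := by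
  induction C generalizing c v with
  | zero => exact .intro [] (by simpa [EvalRule, encodeCode, eval] using h) (by simp)
  | succ => exact .intro [] (by simpa [EvalRule, encodeCode, eval] using h) (by simp)
  | left => exact .intro [] (by simpa [EvalRule, encodeCode, eval] using h) (by simp)
  | right => exact .intro [] (by simpa [EvalRule, encodeCode, eval] using h) (by simp)
  | query =>
    refine .intro [] ?_ (by simp)
    have : v = charFun X c := by simpa [eval] using h
    simp [EvalRule, encodeCode, this]
  | pair a b iha ihb =>
    simp only [eval, Part.map_eq_map, Seq.seq, Part.mem_bind_iff,
      Part.mem_map_iff, exists_exists_and_eq_and] at h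
    obtain ⟨y, hy, z, hz, rfl⟩ := h
    refine .intro [(encodeCode a, c, y), (encodeCode b, c, z)]
      (.inr (.inr (.inr (.inr (.inr (.inl ⟨encodeCode a, encodeCode b, y, z, rfl, rfl,
        by simp, by simp⟩)))))) ?_
    simpa using ⟨iha _ _ hy, ihb _ _ hz⟩
  | comp a b iha ihb =>
    obtain ⟨y, hy, hv⟩ := Part.mem_bind_iff.1 h
    refine .intro [(encodeCode b, c, y), (encodeCode a, y, v)]
      (.inr (.inr (.inr (.inr (.inr (.inr (.inl ⟨encodeCode a, encodeCode b, y, rfl,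
        by simp, by simp⟩))))))) ?_
    simpa using ⟨ihb _ _ hy, iha _ _ hv⟩
  | prec a b iha ihb =>
    rw [← Nat.pair_unpair c] at h ⊢
    generalize (Nat.unpair c).1 = d at h ⊢
    generalize (Nat.unpair c).2 = n at h ⊢
    simp only [eval, Nat.unpaired, Nat.unpair_pair] at h
    induction n generalizing v with
    | zero =>
      refine .intro [(encodeCode a, d, v)] (.inr (.inr (.inr (.inr (.inr (.inr (.inr (.inl
        ⟨encodeCode a, encodeCode b, d, rfl, rfl, by simp⟩)))))))) ?_
      simpa using iha _ _ h
    | succ n ihn =>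
      obtain ⟨y, hy, hv⟩ := Part.mem_bind_iff.1 h
      refine .intro [(encodeCode (prec a b), Nat.pair d n, y),
        (encodeCode b, Nat.pair d (Nat.pair n y), v)]
        (.inr (.inr (.inr (.inr (.inr (.inr (.inr (.inr (.inl
        ⟨encodeCode a, encodeCode b, d, n, y, rfl, rfl, by simp, by simp⟩))))))))) ?_
      simpa using ⟨ihn _ hy, ihb _ _ hv⟩
  | rfind' a iha =>
    rw [← Nat.pair_unpair c] at h ⊢
    generalize (Nat.unpair c).1 = d at h ⊢
    generalize (Nat.unpair c).2 = m at h ⊢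
    simp only [eval, Nat.unpaired, Nat.unpair_pair, Part.mem_map_iff] at h
    obtain ⟨n, hn, rfl⟩ := h
    obtain ⟨h1, h2⟩ := Nat.mem_rfind.1 hn
    have h3 : 0 ∈ a.eval (charFun X) (Nat.pair d (n + m)) := by
      obtain ⟨y, hy, hy0⟩ := (Part.mem_map_iff _).1 h1
      have : y = 0 := by simpa using hy0
      exact this ▸ hy
    have h4 : ∀ k, ∃ y, k < n → y ≠ 0 ∧ y ∈ a.eval (charFun X) (Nat.pair d (k + m)) := by
      intro k
      by_cases hk : k < n
      · obtain ⟨y, hy, hy0⟩ := (Part.mem_map_iff _).1 (h2 hk)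
        exact ⟨y, fun _ => ⟨by simpa using hy0, hy⟩⟩
      · exact ⟨0, fun h => absurd h hk⟩
    choose y hy using h4
    -- A search that stops after `n` steps rests on `n + 1` computations: the zero where it stops
    -- and the nonzero values before it.
    refine .intro ((encodeCode a, Nat.pair d (n + m), 0) ::
      (List.range n).map fun k => (encodeCode a, Nat.pair d (k + m), y k))
      (.inr (.inr (.inr (.inr (.inr (.inr (.inr (.inr (.inr
        ⟨encodeCode a, d, m, n, rfl, rfl, rfl, by simp, fun k hk => ⟨y k, (hy k hk).1, ?_⟩⟩)))))))))
      ?_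
    · exact List.mem_cons_of_mem _ (List.mem_map.2 ⟨k, List.mem_range.2 hk, rfl⟩)
    · rw [List.forall_mem_cons]
      refine ⟨iha _ _ h3, fun t ht => ?_⟩
      obtain ⟨k, hk, rfl⟩ := List.mem_map.1 ht
      exact iha _ _ (hy k (List.mem_range.1 hk)).2

end OracleCode

/-- The index is an argument here, as the upper bound needs: there the index is the input. -/
theorem reIn_mem_Phi : REIn X fun x : ℕ × ℕ × ℕ => x.2.2 ∈ Phi X x.1 x.2.1 := by
  refine (REIn.derivable OracleCode.reIn_evalRule).of_eq fun x => ?_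
  refine ⟨OracleCode.mem_eval_of_derivable, fun h => ?_⟩
  have := OracleCode.derivable_of_mem_eval _ _ _ h
  rwa [OracleCode.encodeCode_ofNatCode] at this

theorem reIn_of_recursiveIn {f : ℕ →. ℕ} (hf : Nat.RecursiveIn (oracleOf X) f) :
    REIn X fun x : ℕ × ℕ => x.2 ∈ f x.1 := by
  obtain ⟨e, rfl⟩ := (exists_Phi_eq_iff X f).2 hf
  exact reIn_mem_Phi.comp (f := fun x : ℕ × ℕ => (e, x)) (by fun_prop)

theorem reIn_graph_of_computableIn {α β : Type*} [Primcodable α] [Primcodable β] {f : α → β}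
    (hf : ComputableIn (oracleOf X) f) : REIn X fun x : α × β => f x.1 = x.2 := by
  refine ((reIn_of_recursiveIn hf).comp
    (f := fun x : α × β => (Encodable.encode x.1, Encodable.encode x.2)) (by fun_prop)).of_eq
    fun x => ?_
  simp [eq_comm]

/-! ### From enumerations back to computations -/

theorem part_some_bind {α β : Type u} (a : α) (f : α → Part β) : (Part.some a >>= f) = f a :=
  Part.bind_some a f

/-- The total function `f` is computable in `X`. -/
def TotalIn (X : Set ℕ) (f : ℕ → ℕ) : Prop :=
  Nat.RecursiveIn (oracleOf X) (f : ℕ →. ℕ)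

namespace TotalIn

theorem of_primrec {f : ℕ → ℕ} (hf : Primrec f) : TotalIn X f :=
  Nat.Primrec.recursiveIn (Primrec.nat_iff.1 hf)

theorem comp {f g : ℕ → ℕ} (hf : TotalIn X f) (hg : TotalIn X g) : TotalIn X fun n => f (g n) :=
  (Nat.RecursiveIn.comp hf hg).of_eq fun _ => part_some_bind _ _

theorem pair {f g : ℕ → ℕ} (hf : TotalIn X f) (hg : TotalIn X g) :
    TotalIn X fun n => Nat.pair (f n) (g n) :=
  (Nat.RecursiveIn.pair hf hg).of_eq fun n => by simp [Seq.seq]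

theorem oracle : TotalIn X (charFun X) := Nat.RecursiveIn.oracle _ rfl

theorem rec {f : ℕ → ℕ} {g : ℕ → ℕ → ℕ → ℕ} (hf : TotalIn X f)
    (hg : TotalIn X fun p => g p.unpair.1 p.unpair.2.unpair.1 p.unpair.2.unpair.2) :
    TotalIn X fun p => Nat.rec (f p.unpair.1) (g p.unpair.1) p.unpair.2 := by
  refine (Nat.RecursiveIn.prec hf hg).of_eq fun p => ?_
  simp only [PFun.coe_val]
  induction p.unpair.2 with
  | zero => rfl
  | succ n ih =>
    refine (congrArg (· >>= _) ih).trans ((part_some_bind _ _).trans ?_)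
    simp

end TotalIn

-- Correctness is decided by recursion along the list, with one oracle query for each pair.
open Classical in
theorem totalIn_correctFor :
    TotalIn X fun n => if CorrectFor X (Denumerable.ofNat (List (ℕ × ℕ)) n) then 1 else 0 := by
  let q (n i : ℕ) : ℕ × ℕ := (Denumerable.ofNat (List (ℕ × ℕ)) n).getD i (0, 0)
  -- The oracle's answer is attached to the input, so that the comparison that remains is primitive
  -- recursive.
  have h1 : TotalIn X fun p => Nat.pair p (charFun X (q p.unpair.1 p.unpair.2.unpair.1).1) :=
    .pair (.of_primrec .id) (.comp .oracle (.of_primrec (by fun_prop)))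
  have h2 : TotalIn X fun p => if charFun X (q p.unpair.1 p.unpair.2.unpair.1).1 =
      (q p.unpair.1 p.unpair.2.unpair.1).2 then p.unpair.2.unpair.2 else 0 := by
    refine (TotalIn.comp (f := fun m => if m.unpair.2 =
      (q m.unpair.1.unpair.1 m.unpair.1.unpair.2.unpair.1).2 then
        m.unpair.1.unpair.2.unpair.2 else 0) (.of_primrec (by fun_prop)) h1).of_eq fun n => by simp
  have h3 := TotalIn.rec (X := X) (f := fun _ => 1)
    (g := fun n i y => if charFun X (q n i).1 = (q n i).2 then y else 0)
    (.of_primrec (by fun_prop)) h2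
  refine (TotalIn.comp h3 (.of_primrec (f := fun n => Nat.pair n
    (Denumerable.ofNat (List (ℕ × ℕ)) n).length) (by fun_prop))).of_eq fun n => ?_
  simp only [PFun.coe_val, Nat.unpair_pair, Part.some_inj, q]
  generalize Denumerable.ofNat (List (ℕ × ℕ)) n = σ
  have : ∀ k ≤ σ.length, (Nat.rec 1 (fun i y => if charFun X (σ.getD i (0, 0)).1 =
      (σ.getD i (0, 0)).2 then y else 0) k : ℕ) = if CorrectFor X (σ.take k) then 1 else 0 := by
    intro k hk
    induction k with
    | zero => simp [CorrectFor]
    | succ k ih =>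
      have hk' : k < σ.length := hk
      refine (congrArg (fun y => if charFun X (σ.getD k (0, 0)).1 = (σ.getD k (0, 0)).2 then y
        else 0) (ih hk'.le)).trans ?_
      simp only [List.getD_eq_getElem?_getD, List.getElem?_eq_getElem hk',
        Option.getD_some, List.take_add_one, correctFor_append, Option.toList_some]
      have : CorrectFor X [ σ[k] ] ↔ charFun X σ[k].1 = σ[k].2 := by simp [CorrectFor]
      rw [this]
      by_cases h4 : CorrectFor X (List.take k σ) <;> simp [h4]
  simpa only [List.take_length] using this σ.length le_rfl

theorem REIn.exists_computableIn {α : Type*} [Primcodable α] {p : α → Prop} (hp : REIn X p) :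
    ∃ R : α → ℕ → Bool, ComputableIn (oracleOf X) (fun x : α × ℕ => R x.1 x.2) ∧
      ∀ a, p a ↔ ∃ c, R a c = true := by
  classical
  obtain ⟨r, hr, h⟩ := hp
  let W (n : ℕ) : ℕ × List (ℕ × ℕ) := Denumerable.ofNat _ n
  refine ⟨fun a n => decide (r (a, W n) ∧ CorrectFor X (W n).2), ?_, fun a => ?_⟩
  · let A (n : ℕ) : List (α × ℕ) := (Encodable.decode (α := α × ℕ) n).toList
    have h1 : TotalIn X fun n => if CorrectFor X (W n.unpair.2).2 then 1 else 0 :=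
      (totalIn_correctFor.comp (.of_primrec
        (f := fun n => Encodable.encode (W n.unpair.2).2) (by fun_prop))).of_eq fun n => by simp
    -- Values are shifted by one: 2 for true, 1 for false, and 0 for inputs that code nothing.
    -- `Nat.ppred` undoes the shift and is undefined at 0, as required there.
    have h2 : TotalIn X fun n => if (∃ x ∈ A n.unpair.1, r (x.1, W x.2)) ∧ n.unpair.2 = 1
        then 2 else if A n.unpair.1 = [] then 0 else 1 := by
      refine .of_primrec ?_
      have : PrimrecPred fun n : ℕ => ∃ x ∈ A n.unpair.1, r (x.1, W x.2) :=
        primrecPred_exists_mem (by fun_prop) (by fun_prop)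
      fun_prop
    have h3 := h2.comp ((TotalIn.of_primrec .id).pair h1)
    have h4 : Nat.RecursiveIn (oracleOf X) fun n => Part.bind (Nat.ppred (
        (fun n => if (∃ x ∈ A n.unpair.1, r (x.1, W x.2)) ∧ n.unpair.2 = 1
        then 2 else if A n.unpair.1 = [] then 0 else 1) (Nat.pair n
          (if CorrectFor X (W n.unpair.2).2 then 1 else 0)))) Part.some :=
      (Nat.RecursiveIn.comp (f := fun n => (Nat.ppred n : Part ℕ))
        (Nat.Partrec.recursiveIn Nat.Partrec.ppred) h3).of_eq fun n => by simp
    refine h4.of_eq fun n => ?_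
    simp only [Nat.unpair_pair, A]
    rcases hd : Encodable.decode (α := α × ℕ) n with _ | x
    · simp
    · have hx : n.unpair.2 = x.2 := by
        have := hd
        rw [Encodable.decode_prod_val] at this
        cases h5 : (Encodable.decode n.unpair.1 : Option α) with
        | none => simp [h5] at this
        | some a => simpa [h5] using congrArg (Option.map Prod.snd) this
      simp only [hx, Option.toList_some, List.mem_singleton, exists_eq_left]
      by_cases h6 : r (x.1, W x.2) <;> by_cases h7 : CorrectFor X (W x.2).2 <;>
        simp [h6, h7]
  · rw [h]
    constructor
    · rintro ⟨w, σ, h1, h2⟩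
      exact ⟨Encodable.encode (w, σ), by simp only [W, Denumerable.ofNat_encode]; simp [h1, h2]⟩
    · rintro ⟨c, hc⟩
      simp only [decide_eq_true_eq] at hc
      exact ⟨_, _, hc.1, hc.2⟩

/-- A total function with a recursively enumerable graph is computable. -/
theorem totalIn_of_reIn_graph {f : ℕ → ℕ} (hf : REIn X fun x : ℕ × ℕ => f x.1 = x.2) :
    TotalIn X f := by
  obtain ⟨R, hR, h⟩ := hf.exists_computableIn
  -- Unbounded search looks for a zero, hence 0 for success.
  have h1 : TotalIn X fun n => if R (n.unpair.1, n.unpair.2.unpair.1) n.unpair.2.unpair.2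
      then 0 else 1 := by
    have h2 := Nat.RecursiveIn.comp (TotalIn.of_primrec (X := X) (f := fun n => 1 - n) (by fun_prop))
      (Nat.RecursiveIn.comp hR (TotalIn.of_primrec (f := fun n : ℕ => Encodable.encode
        ((n.unpair.1, n.unpair.2.unpair.1), n.unpair.2.unpair.2)) (by fun_prop)))
    refine h2.of_eq fun n => ?_
    simp only [PFun.coe_val, Part.bind_eq_bind, Part.bind_some, Encodable.encodek, Part.coe_some,
      Part.map_some]
    refine (part_some_bind _ _).trans ?_
    cases R (n.unpair.1, n.unpair.2.unpair.1) n.unpair.2.unpair.2 <;> simp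
  refine (Nat.RecursiveIn.comp (TotalIn.of_primrec (X := X)
    (Primrec.fst.comp Primrec.unpair)) (Nat.RecursiveIn.rfind h1)).of_eq_tot fun n => ?_
  obtain ⟨c, hc⟩ := (h (n, f n)).1 rfl
  -- One search runs over pairs of a candidate value and a witness for it; the value is the first
  -- component of what is found.
  let P : ℕ → Bool := fun k => R (n, k.unpair.1) k.unpair.2
  have hP : ∃ k, P k = true := ⟨Nat.pair (f n) c, by simpa [P] using hc⟩
  refine Part.mem_bind_iff.2 ⟨Nat.find hP, Nat.mem_rfind.2 ⟨?_, fun {m} hm => ?_⟩, ?_⟩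
  · have := Nat.find_spec hP
    simp only [P] at this
    simp [this]
  · have := Nat.find_min hP hm
    simp only [P] at this
    simp [this]
  · have := (h (n, (Nat.find hP).unpair.1)).2 ⟨_, Nat.find_spec hP⟩
    simpa using this

/-- A recursively enumerable graph gives programs uniformly. -/
theorem exists_computable_Phi_eq {D : ℕ → ℕ → ℕ}
    (hD : REIn X fun x : (ℕ × ℕ) × ℕ => D x.1.1 x.1.2 = x.2) :
    ∃ f : ℕ → ℕ, Computable f ∧ ∀ n c, Phi X (f n) c = Part.some (D n c) := by
  have h1 : TotalIn X fun p => D p.unpair.1 p.unpair.2 :=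
    totalIn_of_reIn_graph (hD.comp
      (f := fun x : ℕ × ℕ => ((x.1.unpair.1, x.1.unpair.2), x.2)) (by fun_prop))
  obtain ⟨e, he⟩ := (exists_Phi_eq_iff X _).2 h1
  -- The s-m-n argument: a program for the constant `n` is hard-wired before a fixed program `e`.
  -- Only the text of the program depends on `n`, so `f` needs no oracle.
  let cst (n : ℕ) : OracleCode := Nat.rec .zero (fun _ c => .comp .succ c) n
  have hcst (n m : ℕ) : (cst n).eval (charFun X) m = Part.some n := by
    induction n with
    | zero => rfl
    | succ n ih =>
      change (cst n).eval (charFun X) m >>= _ = _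
      rw [ih]
      exact part_some_bind _ _
  have hprim : Primrec fun n => (cst n).encodeCode := by
    have : Primrec (fun n => Nat.rec 0 (fun _ y => 2 * (2 * Nat.pair 1 y + 1) + 5) n : ℕ → ℕ) :=
      Primrec.nat_rec₁ (f := fun _ y => 2 * (2 * Nat.pair 1 y + 1) + 5) 0
        (show Primrec fun p : ℕ × ℕ => 2 * (2 * Nat.pair 1 p.2 + 1) + 5 by fun_prop)
    refine this.of_eq fun n => ?_
    induction n with
    | zero => rfl
    | succ n ih => simp only [ih]; rfl
  refine ⟨fun n => (OracleCode.comp (.ofNatCode e)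
    (.pair (cst n) (.pair .left .right))).encodeCode, ?_, fun n c => ?_⟩
  · simp only [OracleCode.encodeCode]
    refine Primrec.to_comp ?_
    fun_prop
  · rw [Phi, OracleCode.ofNatCode_encodeCode]
    have := congrFun he (Nat.pair n c)
    simp only [Phi] at this
    simp only [OracleCode.eval, hcst]
    simp only [Seq.seq, Part.map_eq_map, Part.map_some, Part.bind_some, PFun.coe_val,
      Nat.pair_unpair]
    refine (part_some_bind _ _).trans (this.trans ?_)
    simp

end IndexSets

namespace IndexSets

open FirstOrder Language

/-! ### Substitution on Gödel numbers -/

/-- The entry of `q` at `m`, and the first entry if `m` is out of range. -/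
def entry (q : List ℕ) (m : ℕ) : ℕ := q.getD m (q.headD 0)

theorem entry_of_lt {q : List ℕ} {m : ℕ} (h : m < q.length) : entry q m = q[m] := by
  simp [entry, h]

/-- Out of range, `entry` returns an element of the list itself, so it commutes with `f` at every
`m`; a fixed default would not. -/
theorem entry_map (f : ℕ → ℕ) {q : List ℕ} (hq : q ≠ []) (m : ℕ) :
    entry (q.map f) m = f (entry q m) := by
  cases q with
  | nil => exact absurd rfl hq
  | cons a q => cases m <;> simp [entry, Option.getD_map]

theorem entry_of_prefix {q r : List ℕ} (h : q <+: r) {m : ℕ} (hm : m < q.length) :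
    entry r m = entry q m := by
  rw [entry_of_lt hm, entry_of_lt (hm.trans_le h.length_le), h.getElem hm]

@[fun_prop]
theorem primrec_entry {α : Type*} [Primcodable α] {f : α → List ℕ} {g : α → ℕ}
    (hf : Primrec f) (hg : Primrec g) : Primrec fun a => entry (f a) (g a) := by
  have h : Primrec fun a => (f a).headD 0 :=
    (Primrec.option_getD.comp (Primrec.list_head?.comp hf) (Primrec.const 0)).of_eq fun a => by
      simp
  refine (Primrec.option_getD.comp (Primrec.list_getElem?.comp hf hg) h).of_eq fun a => ?_
  rw [entry, List.getD_eq_getElem?_getD]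

/-- Substitution of the entries of `q` for the variables, in a letter of a word in Polish
notation. -/
def substLetter (q : List ℕ) (a : ℕ) : ℕ :=
  if a % 2 = 0 then 2 * entry q (a / 2) else a

/-- Substitution of the entries of `q` for the variables, in the number of a term. -/
def substTerm (q : List ℕ) (w : ℕ) : ℕ :=
  Encodable.encode ((Denumerable.ofNat (List ℕ) w).map (substLetter q))

/-- Substitution of the entries of `q` for the variables, in the number of an atomic sentence. -/
def substCode (q : List ℕ) (d : ℕ) : ℕ :=
  if d % 2 = 0 then
    2 * Nat.pair (substTerm q (d / 2).unpair.1) (substTerm q (d / 2).unpair.2)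
  else
    2 * Nat.pair (d / 2).unpair.1
      (Encodable.encode ((Denumerable.ofNat (List ℕ) (d / 2).unpair.2).map (substTerm q))) + 1

@[fun_prop]
theorem primrec_substTerm {α : Type*} [Primcodable α] {f : α → List ℕ} {g : α → ℕ}
    (hf : Primrec f) (hg : Primrec g) : Primrec fun a => substTerm (f a) (g a) := by
  unfold substTerm substLetter
  fun_prop

@[fun_prop]
theorem primrec_substCode {α : Type*} [Primcodable α] {f : α → List ℕ} {g : α → ℕ}
    (hf : Primrec f) (hg : Primrec g) : Primrec fun a => substCode (f a) (g a) := by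
  unfold substCode
  fun_prop

theorem encode_list_eq {α : Type*} [Encodable α] (l : List α) :
    Encodable.encode l = Encodable.encode (l.map Encodable.encode) := by
  induction l with
  | nil => rfl
  | cons a l ih => simp [Encodable.encode_list_cons, ih]

theorem lt_encode_of_mem {l : List ℕ} {a : ℕ} (h : a ∈ l) : a < Encodable.encode l := by
  induction l with
  | nil => simp at h
  | cons b l ih =>
    rw [Encodable.encode_list_cons, Nat.lt_succ_iff]
    rcases List.mem_cons.1 h with rfl | h
    · exact Nat.left_le_pair _ _
    · exact (ih h).le.trans (Nat.right_le_pair _ _)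

variable {L : FirstOrder.Language.{u, v}}

theorem listEncode_relabel {α β : Type*} (f : α → β) (t : L.Term α) :
    (t.relabel f).listEncode = t.listEncode.map (Sum.map f id) := by
  induction t with
  | var a => rfl
  | func F ts ih =>
    simp only [Term.relabel, Term.listEncode, List.map_cons, List.map_flatMap, Sum.map_inr, id_eq]
    congr 2
    funext i
    exact ih i

section Term

variable [Encodable ((n : ℕ) × L.Functions n)]

theorem encode_term (t : L.Term ℕ) :
    Encodable.encode t = Encodable.encode (t.listEncode.map Encodable.encode) := by
  rw [← encode_list_eq]
  rfl

/-- In the Polish word of a term, the variable `m` has the even code `2 * m` and function symbols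
have odd codes, so substitution acts letter by letter. -/
theorem encode_relabel (q : List ℕ) (t : L.Term ℕ) :
    Encodable.encode (t.relabel fun m => entry q m) = substTerm q (Encodable.encode t) := by
  rw [encode_term, encode_term, substTerm, Denumerable.ofNat_encode, listEncode_relabel,
    List.map_map, List.map_map]
  congr 1
  refine List.map_congr_left fun a _ => ?_
  rcases a with m | F
  · simp [substLetter]
  · simp [substLetter]

theorem lt_encode_of_mem_varFinset {t : L.Term ℕ} {m : ℕ} (h : m ∈ t.varFinset) :
    m < Encodable.encode t := by
  have h1 : Sum.inl m ∈ t.listEncode := by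
    induction t with
    | var a =>
      simp only [Term.varFinset, Finset.mem_singleton] at h
      simp [Term.listEncode, h]
    | func F ts ih =>
      simp only [Term.varFinset, Finset.mem_biUnion, Finset.mem_univ, true_and] at h
      obtain ⟨i, hi⟩ := h
      simp only [Term.listEncode, List.mem_cons, reduceCtorEq, List.mem_flatMap,
        List.mem_finRange, true_and, false_or]
      exact ⟨i, ih i hi⟩
  rw [encode_term]
  refine lt_of_le_of_lt ?_ (lt_encode_of_mem (List.mem_map_of_mem h1))
  simp only [Encodable.encode_inl, Encodable.encode_nat]
  omega

end Term

theorem realize_congr {M : Type*} [L.Structure M] {t : L.Term ℕ} {v v' : ℕ → M}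
    (h : ∀ m ∈ t.varFinset, v m = v' m) : t.realize v = t.realize v' := by
  induction t with
  | var a => exact h a (by simp [Term.varFinset])
  | func F ts ih =>
    simp only [Term.realize_func]
    congr 1
    funext i
    exact ih i fun m hm => h m (by
      simp only [Term.varFinset, Finset.mem_biUnion, Finset.mem_univ, true_and]
      exact ⟨i, hm⟩)

namespace AtomicSentence

/-- Truth of an atomic sentence under an interpretation of the numbers. -/
def Realize {M : Type*} [L.Structure M] (v : ℕ → M) : AtomicSentence L → Prop
  | .equal t s => t.realize v = s.realize v
  | .rel R ts => Structure.RelMap R fun i => (ts i).realize v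

/-- Substitution of numbers for numbers in an atomic sentence. -/
def relabel (f : ℕ → ℕ) : AtomicSentence L → AtomicSentence L
  | .equal t s => .equal (t.relabel f) (s.relabel f)
  | .rel R ts => .rel R fun i => (ts i).relabel f

theorem holds_iff_realize (B : L.Structure ℕ) (φ : AtomicSentence L) :
    φ.Holds B ↔ φ.Realize id := by
  cases φ <;> rfl

theorem realize_relabel {M : Type*} [L.Structure M] (f : ℕ → ℕ) (v : ℕ → M)
    (φ : AtomicSentence L) : (φ.relabel f).Realize v ↔ φ.Realize (v ∘ f) := by
  cases φ <;> simp [relabel, Realize]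

theorem realize_embedding {M N : Type*} [L.Structure M] [L.Structure N] (f : M ↪[L] N) (v : ℕ → M)
    (φ : AtomicSentence L) : φ.Realize (f ∘ v) ↔ φ.Realize v := by
  cases φ with
  | equal t s => simp [Realize, HomClass.realize_term]
  | rel R ts =>
    simp only [Realize, HomClass.realize_term]
    exact StrongHomClass.map_rel f R fun i => (ts i).realize v

theorem realize_equiv {M N : Type*} [L.Structure M] [L.Structure N] (f : M ≃[L] N) (v : ℕ → M)
    (φ : AtomicSentence L) : φ.Realize (f ∘ v) ↔ φ.Realize v :=
  realize_embedding f.toEmbedding v φ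

variable [Encodable ((n : ℕ) × L.Functions n)] [Encodable ((n : ℕ) × L.Relations n)]

theorem code_relabel (q : List ℕ) (φ : AtomicSentence L) :
    (φ.relabel fun m => entry q m).code = substCode q φ.code := by
  cases φ with
  | equal t s =>
    have h (k : ℕ) : 2 * k / 2 = k := by omega
    simp only [relabel, code, substCode, encode_relabel, h, Nat.unpair_pair]
    rw [if_pos (by omega)]
  | rel R ts =>
    have h (k : ℕ) : (2 * k + 1) / 2 = k := by omega
    simp only [relabel, code, substCode, encode_relabel, h, Nat.unpair_pair]
    rw [if_neg (by omega), Denumerable.ofNat_encode, List.map_ofFn]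
    rfl

/-- Every number mentioned in `φ` is below its Gödel number. This is why finite lists suffice to
describe finite parts of a diagram. -/
theorem realize_congr_code {M : Type*} [L.Structure M] {φ : AtomicSentence L} {v v' : ℕ → M}
    (h : ∀ m < φ.code, v m = v' m) : φ.Realize v ↔ φ.Realize v' := by
  cases φ with
  | equal t s =>
    have h1 := Nat.left_le_pair (Encodable.encode t) (Encodable.encode s)
    have h2 := Nat.right_le_pair (Encodable.encode t) (Encodable.encode s)
    simp only [code] at h
    simp only [Realize]
    rw [realize_congr fun m hm => h m (by have := lt_encode_of_mem_varFinset hm; omega),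
      realize_congr (t := s) fun m hm => h m (by have := lt_encode_of_mem_varFinset hm; omega)]
  | @rel n R ts =>
    have h1 := Nat.right_le_pair (Encodable.encode (⟨n, R⟩ : (n : ℕ) × L.Relations n))
      (Encodable.encode (List.ofFn fun i => Encodable.encode (ts i)))
    have h2 (i : Fin n) : Encodable.encode (ts i) <
        Encodable.encode (List.ofFn fun i => Encodable.encode (ts i)) :=
      lt_encode_of_mem ((List.mem_ofFn' _ _).2 ⟨i, rfl⟩)
    simp only [code] at h
    simp only [Realize]
    rw [show (fun i => (ts i).realize v) = fun i => (ts i).realize v' from funext fun i =>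
      realize_congr fun m hm => h m (by
        have := lt_encode_of_mem_varFinset hm
        have := h2 i
        omega)]

end AtomicSentence

/-! ### Truth in a structure on the natural numbers, in terms of Gödel numbers -/

variable [Encodable ((n : ℕ) × L.Functions n)] [Encodable ((n : ℕ) × L.Relations n)]

/-- `d` is the number of a true atomic sentence. -/
def TrueCode (B : L.Structure ℕ) (d : ℕ) : Prop := 2 * d ∈ atomicDiagram B

/-- `d` is the number of a false atomic sentence. -/
def FalseCode (B : L.Structure ℕ) (d : ℕ) : Prop := 2 * d + 1 ∈ atomicDiagram B

section

variable {B : L.Structure ℕ}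

theorem trueCode_iff {d : ℕ} :
    TrueCode B d ↔ ∃ φ : AtomicSentence L, φ.code = d ∧ φ.Holds B := by
  simp only [TrueCode, atomicDiagram, Set.mem_ofPred_eq]
  refine exists_congr fun φ => ⟨?_, ?_⟩
  · rintro (⟨h1, h2⟩ | ⟨-, h2⟩)
    · exact ⟨by omega, h1⟩
    · omega
  · rintro ⟨rfl, h⟩
    exact .inl ⟨h, rfl⟩

theorem falseCode_iff {d : ℕ} :
    FalseCode B d ↔ ∃ φ : AtomicSentence L, φ.code = d ∧ ¬ φ.Holds B := by
  simp only [FalseCode, atomicDiagram, Set.mem_ofPred_eq]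
  refine exists_congr fun φ => ⟨?_, ?_⟩
  · rintro (⟨-, h2⟩ | ⟨h1, h2⟩)
    · omega
    · exact ⟨by omega, h1⟩
  · rintro ⟨rfl, h⟩
    exact .inr ⟨h, rfl⟩

theorem trueCode_code {φ : AtomicSentence L} : TrueCode B φ.code ↔ φ.Holds B := by
  rw [trueCode_iff]
  exact ⟨fun ⟨ψ, h1, h2⟩ => AtomicSentence.code_injective h1 ▸ h2, fun h => ⟨φ, rfl, h⟩⟩

theorem falseCode_code {φ : AtomicSentence L} : FalseCode B φ.code ↔ ¬ φ.Holds B := by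
  rw [falseCode_iff]
  exact ⟨fun ⟨ψ, h1, h2⟩ => AtomicSentence.code_injective h1 ▸ h2, fun h => ⟨φ, rfl, h⟩⟩

theorem trueCode_substCode {q : List ℕ} {φ : AtomicSentence L} :
    TrueCode B (substCode q φ.code) ↔ φ.Realize fun m => entry q m := by
  rw [← AtomicSentence.code_relabel, trueCode_code, AtomicSentence.holds_iff_realize,
    AtomicSentence.realize_relabel]
  rfl

theorem falseCode_substCode {q : List ℕ} {φ : AtomicSentence L} :
    FalseCode B (substCode q φ.code) ↔ ¬ φ.Realize fun m => entry q m := by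
  rw [← AtomicSentence.code_relabel, falseCode_code, AtomicSentence.holds_iff_realize,
    AtomicSentence.realize_relabel]
  rfl

/-- Whether `d` is a Gödel number at all can thus be read off the diagram. -/
theorem trueCode_or_falseCode {d : ℕ} :
    TrueCode B d ∨ FalseCode B d ↔ ∃ φ : AtomicSentence L, φ.code = d := by
  rw [trueCode_iff, falseCode_iff]
  constructor
  · rintro (⟨φ, h, -⟩ | ⟨φ, h, -⟩) <;> exact ⟨φ, h⟩
  · rintro ⟨φ, h⟩
    by_cases h' : φ.Holds B
    · exact .inl ⟨φ, h, h'⟩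
    · exact .inr ⟨φ, h, h'⟩

open Classical in
theorem charFun_apply (S : Set ℕ) (c : ℕ) : charFun S c = if c ∈ S then 1 else 0 := by
  simp [charFun, Set.indicator_apply]

/-- Agreement of an interpretation of the numbers in `B`, given by the list `q`, with `v` being
the value at `c` of the characteristic function of the diagram so described. -/
def DiagramValue (B : L.Structure ℕ) (q : List ℕ) (c v : ℕ) : Prop :=
  ∃ d,
    (c = 2 * d ∧ ((v = 1 ∧ (TrueCode B d ∨ FalseCode B d) ∧ TrueCode B (substCode q d)) ∨
      (v = 0 ∧ ((¬ TrueCode B d ∧ ¬ FalseCode B d) ∨ FalseCode B (substCode q d))))) ∨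
    (c = 2 * d + 1 ∧ ((v = 1 ∧ (TrueCode B d ∨ FalseCode B d) ∧ FalseCode B (substCode q d)) ∨
      (v = 0 ∧ ((¬ TrueCode B d ∧ ¬ FalseCode B d) ∨ TrueCode B (substCode q d)))))

theorem diagramValue_iff {B' : L.Structure ℕ} {q : List ℕ} {c v : ℕ}
    (h : ∀ φ : AtomicSentence L, φ.code = c / 2 →
      (φ.Holds B' ↔ @AtomicSentence.Realize _ _ B (fun m => entry q m) φ)) :
    DiagramValue B q c v ↔ charFun (atomicDiagram B') c = v := by
  classical
  obtain ⟨d, hd⟩ : ∃ d, c = 2 * d ∨ c = 2 * d + 1 := ⟨c / 2, by omega⟩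
  have hc : c / 2 = d := by omega
  rw [hc] at h
  have hDV : DiagramValue B q c v ↔
    (c = 2 * d ∧ ((v = 1 ∧ (TrueCode B d ∨ FalseCode B d) ∧ TrueCode B (substCode q d)) ∨
      (v = 0 ∧ ((¬ TrueCode B d ∧ ¬ FalseCode B d) ∨ FalseCode B (substCode q d))))) ∨
    (c = 2 * d + 1 ∧ ((v = 1 ∧ (TrueCode B d ∨ FalseCode B d) ∧ FalseCode B (substCode q d)) ∨
      (v = 0 ∧ ((¬ TrueCode B d ∧ ¬ FalseCode B d) ∨ TrueCode B (substCode q d))))) := by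
    refine ⟨?_, fun h => ⟨d, h⟩⟩
    rintro ⟨d', hd'⟩
    have : d' = d := by omega
    exact this ▸ hd'
  rw [hDV]
  by_cases hφ : ∃ φ : AtomicSentence L, φ.code = d
  · obtain ⟨φ, rfl⟩ := hφ
    have h1 := h φ rfl
    simp only [trueCode_or_falseCode, ← not_or, exists_apply_eq_apply, not_true, false_or,
      true_and, trueCode_substCode, falseCode_substCode, ← h1]
    rw [charFun_apply]
    rcases hd with rfl | rfl
    · change _ ↔ (if TrueCode B' φ.code then 1 else 0) = v
      rw [trueCode_code]
      by_cases h2 : φ.Holds B' <;> simp [h2, eq_comm]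
    · change _ ↔ (if FalseCode B' φ.code then 1 else 0) = v
      rw [falseCode_code]
      by_cases h2 : φ.Holds B' <;> simp [h2, eq_comm]
  -- Here `d` is no Gödel number, and the characteristic function of every diagram is 0 at `c`.
  · have h1 : ¬ TrueCode B d ∧ ¬ FalseCode B d := by rwa [← not_or, trueCode_or_falseCode]
    have h2 : ¬ TrueCode B' d ∧ ¬ FalseCode B' d := by rwa [← not_or, trueCode_or_falseCode]
    rw [charFun_apply]
    rcases hd with rfl | rfl
    · change _ ↔ (if TrueCode B' d then 1 else 0) = v
      simp [h1, h2, eq_comm]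
    · change _ ↔ (if FalseCode B' d then 1 else 0) = v
      simp [h1, h2, eq_comm]

end

section

variable {X : Set ℕ} {B : L.Structure ℕ} {α : Type*} [Primcodable α]

variable (hB : ComputableIn (oracleOf X) (charFun (atomicDiagram B)))
include hB

theorem reIn_mem_diagram {f : α → ℕ} (hf : Primrec f) :
    REIn X fun a => f a ∈ atomicDiagram B :=
  ((reIn_graph_of_computableIn hB).comp (f := fun a => (f a, 1)) (by fun_prop)).of_eq fun a => by
    classical
    rw [charFun_apply]
    simp

theorem reIn_notMem_diagram {f : α → ℕ} (hf : Primrec f) :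
    REIn X fun a => ¬ f a ∈ atomicDiagram B :=
  ((reIn_graph_of_computableIn hB).comp (f := fun a => (f a, 0)) (by fun_prop)).of_eq fun a => by
    classical
    rw [charFun_apply]
    simp

theorem reIn_trueCode {f : α → ℕ} (hf : Primrec f) : REIn X fun a => TrueCode B (f a) :=
  reIn_mem_diagram hB (f := fun a => 2 * f a) (by fun_prop)

theorem reIn_falseCode {f : α → ℕ} (hf : Primrec f) : REIn X fun a => FalseCode B (f a) :=
  reIn_mem_diagram hB (f := fun a => 2 * f a + 1) (by fun_prop)

theorem reIn_not_trueCode {f : α → ℕ} (hf : Primrec f) : REIn X fun a => ¬ TrueCode B (f a) :=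
  reIn_notMem_diagram hB (f := fun a => 2 * f a) (by fun_prop)

theorem reIn_not_falseCode {f : α → ℕ} (hf : Primrec f) : REIn X fun a => ¬ FalseCode B (f a) :=
  reIn_notMem_diagram hB (f := fun a => 2 * f a + 1) (by fun_prop)

theorem reIn_diagramValue {q : α → List ℕ} {c v : α → ℕ} (hq : Primrec q) (hc : Primrec c)
    (hv : Primrec v) : REIn X fun a => DiagramValue B (q a) (c a) (v a) := by
  unfold DiagramValue
  have h1 := reIn_trueCode hB (f := fun x : α × ℕ => x.2) (by fun_prop)
  have h2 := reIn_falseCode hB (f := fun x : α × ℕ => x.2) (by fun_prop)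
  have h3 := reIn_not_trueCode hB (f := fun x : α × ℕ => x.2) (by fun_prop)
  have h4 := reIn_not_falseCode hB (f := fun x : α × ℕ => x.2) (by fun_prop)
  have h5 := reIn_trueCode hB (f := fun x : α × ℕ => substCode (q x.1) x.2) (by fun_prop)
  have h6 := reIn_falseCode hB (f := fun x : α × ℕ => substCode (q x.1) x.2) (by fun_prop)
  refine .exists' (.or (.and (by fun_prop) (.or (.and (by fun_prop) (.and (h1.or h2) h5))
    (.and (by fun_prop) (.or (h3.and h4) h6)))) (.and (by fun_prop) (.or (.and (by fun_prop)
    (.and (h1.or h2) h6)) (.and (by fun_prop) (.or (h3.and h4) h5)))))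

end

end IndexSets

namespace IndexSets

open FirstOrder Language

variable {L : FirstOrder.Language.{u, v}}

/-! ### `Σ⁰₁`-elementary embeddings -/

section Elementary

variable {M N P : Type*} [L.Structure M] [L.Structure N] [L.Structure P]

theorem isExistential_exs {α : Type*} {n : ℕ} {φ : L.BoundedFormula α n} (h : φ.IsExistential) :
    BoundedFormula.IsExistential φ.exs := by
  induction n with
  | zero => exact h
  | succ n ih => exact ih h.ex

theorem isQF_foldr_inf {α : Type*} {n : ℕ} (l : List (L.BoundedFormula α n))
    (h : ∀ φ ∈ l, φ.IsQF) : (l.foldr (· ⊓ ·) ⊤).IsQF := by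
  induction l with
  | nil => exact .top
  | cons φ l ih =>
    rw [List.forall_mem_cons] at h
    exact h.1.inf (ih h.2)

/-- An atomic sentence, as a formula with the numbers replaced by variables. -/
def AtomicSentence.toFormula {α : Type*} {n : ℕ} (ρ : ℕ → α ⊕ Fin n) :
    AtomicSentence L → L.BoundedFormula α n
  | .equal t s => (t.relabel ρ).bdEqual (s.relabel ρ)
  | .rel R ts => R.boundedFormula fun i => (ts i).relabel ρ

theorem AtomicSentence.isQF_toFormula {α : Type*} {n : ℕ} (ρ : ℕ → α ⊕ Fin n)
    (φ : AtomicSentence L) : (φ.toFormula ρ).IsQF := by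
  cases φ with
  | equal t s => exact (BoundedFormula.IsAtomic.equal _ _).isQF
  | rel R ts => exact (BoundedFormula.IsAtomic.rel _ _).isQF

theorem AtomicSentence.realize_toFormula {α : Type*} {n : ℕ} (ρ : ℕ → α ⊕ Fin n)
    (φ : AtomicSentence L) (v : α → M) (xs : Fin n → M) :
    (φ.toFormula ρ).Realize v xs ↔ φ.Realize (Sum.elim v xs ∘ ρ) := by
  cases φ with
  | equal t s => simp [toFormula, Realize, BoundedFormula.realize_bdEqual]
  | rel R ts => simp [toFormula, Realize, BoundedFormula.realize_rel]

/-- A finite part of the atomic diagram of `M` can be realized in a `Σ⁰₁`-elementary submodel,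
with the elements of the submodel fixed. -/
theorem IsSigmaOneElementary.exists_realize_iff {f : N ↪[L] M} (hf : IsSigmaOneElementary f)
    {a b : ℕ} (hab : a ≤ b) (r : ℕ → N) (v : ℕ → M) (hr : ∀ i < a, v i = f (r i))
    (hv : ∀ m, b ≤ m → v m = v b) {Φ : Set (AtomicSentence L)} (hΦ : Φ.Finite) :
    ∃ v' : ℕ → N, (∀ i < a, v' i = r i) ∧ ∀ φ ∈ Φ, φ.Realize v ↔ φ.Realize v' := by
  classical
  -- Numbers below `a` become free variables, the others bound ones. All numbers from `b` on share
  -- the last bound variable, which is sound because `v` is constant there.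
  let ρ (m : ℕ) : Fin a ⊕ Fin (b - a + 1) :=
    if h : m < a then .inl ⟨m, h⟩ else .inr ⟨min (m - a) (b - a), by omega⟩
  -- The literal that is true under `v`; the existential closure of the conjunction of these is what
  -- descends to `N`.
  let lit (φ : AtomicSentence L) : L.BoundedFormula (Fin a) (b - a + 1) :=
    if φ.Realize v then φ.toFormula ρ else (φ.toFormula ρ).not
  let ψ : L.BoundedFormula (Fin a) (b - a + 1) :=
    (hΦ.toFinset.toList.map lit).foldr (· ⊓ ·) ⊤
  have hlit (φ : AtomicSentence L) : (lit φ).IsQF := by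
    simp only [lit]
    split_ifs
    · exact φ.isQF_toFormula ρ
    · exact (φ.isQF_toFormula ρ).not
  have hψ : ψ.IsQF := by
    refine isQF_foldr_inf _ fun χ hχ => ?_
    obtain ⟨φ, -, rfl⟩ := List.mem_map.1 hχ
    exact hlit φ
  have hv' : Sum.elim (fun i : Fin a => f (r i))
      (fun i : Fin (b - a + 1) => v (a + i)) ∘ ρ = v := by
    funext m
    simp only [ρ, Function.comp]
    split_ifs with h
    · simp [hr m h]
    · simp only [Sum.elim_inr]
      by_cases hm : m ≤ b
      · congr 1; omega
      · rw [hv m (by omega)]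
        congr 1; omega
  have h1 : ψ.Realize (fun i : Fin a => f (r i)) (fun i : Fin (b - a + 1) => v (a + i)) := by
    rw [BoundedFormula.realize_foldr_inf]
    intro χ hχ
    obtain ⟨φ, -, rfl⟩ := List.mem_map.1 hχ
    simp only [lit]
    split_ifs with h
    · rwa [AtomicSentence.realize_toFormula, hv']
    · rwa [BoundedFormula.realize_not, AtomicSentence.realize_toFormula, hv']
  have h2 := (hf a ψ.exs (isExistential_exs hψ.isExistential) fun i => r i).1
    (BoundedFormula.realize_exs.2 ⟨_, h1⟩)
  obtain ⟨xs, hxs⟩ := BoundedFormula.realize_exs.1 h2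
  rw [BoundedFormula.realize_foldr_inf] at hxs
  refine ⟨Sum.elim (fun i : Fin a => r i) xs ∘ ρ, fun i hi => by simp [ρ, hi], fun φ hφ => ?_⟩
  have h3 := hxs (lit φ) (List.mem_map_of_mem (by simpa using hφ))
  simp only [lit] at h3
  split_ifs at h3 with h
  · rw [AtomicSentence.realize_toFormula] at h3
    exact iff_of_true h h3
  · rw [BoundedFormula.realize_not, AtomicSentence.realize_toFormula] at h3
    exact iff_of_false h h3

theorem IsSigmaOneElementary.comp {f : N ↪[L] P} {g : M ↪[L] N} (hf : IsSigmaOneElementary f)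
    (hg : IsSigmaOneElementary g) : IsSigmaOneElementary (f.comp g) :=
  fun n φ hφ b => (hf n φ hφ fun i => g (b i)).trans (hg n φ hφ b)

theorem isSigmaOneElementary_equiv (e : M ≃[L] N) : IsSigmaOneElementary e.toEmbedding :=
  fun _ φ _ _ => StrongHomClass.realize_formula e φ

/-- The iterates of a self-embedding. -/
def iterEmbedding (g : M ↪[L] M) : ℕ → (M ↪[L] M)
  | 0 => Embedding.refl L M
  | n + 1 => g.comp (iterEmbedding g n)

@[simp]
theorem coe_iterEmbedding (g : M ↪[L] M) (n : ℕ) : ⇑(iterEmbedding g n) = g^[n] := by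
  induction n with
  | zero => rfl
  | succ n ih =>
    rw [Function.iterate_succ', ← ih]
    rfl

theorem IsSigmaOneElementary.iter {g : M ↪[L] M} (hg : IsSigmaOneElementary g) (n : ℕ) :
    IsSigmaOneElementary (iterEmbedding g n) := by
  induction n with
  | zero => exact fun _ _ _ _ => Iff.rfl
  | succ n ih => exact hg.comp ih

/-- A structure isomorphic to a self-reflective one has a `Σ⁰₁`-elementary self-embedding that is
not surjective. -/
theorem SelfReflective.exists_embedding (h : SelfReflective L N) (e : M ≃[L] N) :
    ∃ g : M ↪[L] M, IsSigmaOneElementary g ∧ ¬ Function.Surjective g := by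
  obtain ⟨K, hK, ⟨i⟩, hi⟩ := h
  refine ⟨e.symm.toEmbedding.comp (K.subtype.comp (i.symm.toEmbedding.comp e.toEmbedding)),
    (isSigmaOneElementary_equiv _).comp (hi.comp ((isSigmaOneElementary_equiv _).comp
      (isSigmaOneElementary_equiv _))), fun hs => hK ?_⟩
  rw [eq_top_iff]
  intro x _
  obtain ⟨y, hy⟩ := hs (e.symm x)
  have : (i.symm (e y) : N) = x := e.symm.injective hy
  exact this ▸ (i.symm (e y)).2

end Elementary

/-! ### Limits along a self-embedding -/

section Limit

variable {M N P : Type*} [L.Structure M] [L.Structure N] [L.Structure P]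

/-- The chain consists of the ranges of the `h i`. Inside the range of `h (i + 1)`, the previous one
is the image of `g i`, so strictness and elementarity are inherited from `g i`. -/
theorem isUnionOfSigmaOneChain_of_embeddings {g : ℕ → (M ↪[L] M)}
    {h : ℕ → (M ↪[L] N)} (e : M ≃[L] P) (hg : ∀ i, IsSigmaOneElementary (g i)) (hg' : ∀ i, ¬ Function.Surjective (g i))
    (hh : ∀ i x, h (i + 1) (g i x) = h i x) (hN : ∀ z, ∃ i x, h i x = z) :
    ¬ Structure.FG L N ∧ IsUnionOfSigmaOneChain L N P := by
  have hle (i : ℕ) : (h i).toHom.range ≤ (h (i + 1)).toHom.range := by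
    rintro _ ⟨x, rfl⟩
    exact ⟨g i x, hh i x⟩
  have hmono : Monotone fun i => (h i).toHom.range := monotone_nat_of_le_succ hle
  have hne (i : ℕ) : (h i).toHom.range ≠ (h (i + 1)).toHom.range := by
    intro heq
    refine hg' i fun x => ?_
    have : h (i + 1) x ∈ (h i).toHom.range := heq ▸ ⟨x, rfl⟩
    obtain ⟨y, hy⟩ := this
    exact ⟨y, (h (i + 1)).injective ((hh i y).trans hy)⟩
  refine ⟨fun hfg => ?_, fun i => (h i).toHom.range, fun i => ⟨e.comp (h i).equivRange.symm⟩,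
    fun i => ⟨hne i, hle i, fun n φ hφ b => ?_⟩, fun z => ?_⟩
  -- Finitely many generators all lie in one member of the chain, which would then be everything and
  -- stop the chain.
  · obtain ⟨S, hS, hcl⟩ := Structure.fg_iff.1 hfg
    choose lev pre hlev using hN
    obtain ⟨i, hi⟩ := (hS.image lev).bddAbove
    have hi : S ⊆ (h i).toHom.range := fun z hz =>
      hmono (hi (Set.mem_image_of_mem lev hz)) ⟨pre z, hlev z⟩
    have htop : (h i).toHom.range = ⊤ := by
      rw [eq_top_iff, ← hcl]
      exact Substructure.closure_le.2 hi
    refine hne i ?_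
    rw [htop]
    exact (top_le_iff.1 (htop ▸ hle i)).symm
  · have hb (k : Fin n) : ∃ y, (h i).equivRange y = b k := (h i).equivRange.surjective (b k)
    choose y hy using hb
    have h1 : (fun k => Substructure.inclusion (hle i) (b k)) =
        (h (i + 1)).equivRange ∘ fun k => g i (y k) := by
      funext k
      refine Subtype.ext ?_
      have : (b k : N) = h i (y k) := congrArg Subtype.val (hy k).symm
      exact this.trans (hh i (y k)).symm
    have h2 : b = (h i).equivRange ∘ y := funext fun k => (hy k).symm
    rw [h1, h2, StrongHomClass.realize_formula, StrongHomClass.realize_formula]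
    exact hg i n φ hφ y
  · obtain ⟨i, x, rfl⟩ := hN z
    exact ⟨i, x, rfl⟩

/-- The direct limit of copies of `M` in which the map from `i` to `j` is the iterate of `g` by the
difference of levels; monotonicity makes these exponents add up. -/
theorem exists_limit {M : Type w} [L.Structure M] (g : M ↪[L] M) {κ : ℕ → ℕ} (hκ : Monotone κ) :
    ∃ (Q : Type w) (_ : L.Structure Q) (h : ℕ → (M ↪[L] Q)),
      (∀ i j, i ≤ j → ∀ x, h j (g^[κ j - κ i] x) = h i x) ∧ ∀ z, ∃ i x, h i x = z := by
  let f (i j : ℕ) (_ : i ≤ j) : M ↪[L] M := iterEmbedding g (κ j - κ i)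
  have : DirectedSystem (fun _ : ℕ => M) fun i j h => f i j h := by
    refine ⟨fun i x => by simp [f], fun i j k hij hjk x => ?_⟩
    simp only [f, coe_iterEmbedding, ← Function.iterate_add_apply]
    have := hκ hij
    have := hκ hjk
    congr 1
    omega
  refine ⟨Language.DirectLimit (fun _ : ℕ => M) f, inferInstance,
    fun i => DirectLimit.of L ℕ (fun _ => M) f i, fun i j hij x => ?_, DirectLimit.exists_of⟩
  rw [← DirectLimit.of_f (hij := hij)]
  exact congrArg _ (congrFun (coe_iterEmbedding g _) x).symm

/-- A sequence of lists that grows along the iterates of a self-embedding enumerates a limit. -/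
theorem exists_limit_enumeration [L.Structure ℕ] (g : ℕ ↪[L] ℕ) {κ : ℕ → ℕ} (hκ : Monotone κ)
    {q : ℕ → List ℕ} (hq : ∀ i j, i ≤ j → (q i).map g^[κ j - κ i] <+: q j)
    (hnd : ∀ i, (q i).Nodup) (hlen : ∀ i, i ≤ (q i).length)
    (hcov : ∀ i x, ∃ j, i ≤ j ∧ g^[κ j - κ i] x ∈ q j) :
    ∃ (Q : Type) (_ : L.Structure Q) (h : ℕ → (ℕ ↪[L] Q)) (p : ℕ ≃ Q),
      (∀ i j, i ≤ j → ∀ x, h j (g^[κ j - κ i] x) = h i x) ∧ (∀ z, ∃ i x, h i x = z) ∧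
      ∀ i m, m < (q i).length → h i (entry (q i) m) = p m := by
  obtain ⟨Q, _, h, hh, hQ⟩ := exists_limit g hκ
  have hmove (i j m : ℕ) (hij : i ≤ j) (hm : m < (q i).length) :
      h i (entry (q i) m) = h j (entry (q j) m) := by
    rw [← hh i j hij, ← entry_map g^[κ j - κ i] (List.ne_nil_of_length_pos (by omega)),
      entry_of_prefix (hq i j hij) (by simpa using hm)]
  -- Index `m + 1` is used because the list there has length at least `m + 1`; any other list with
  -- an entry at `m` gives the same point.
  let p (m : ℕ) : Q := h (m + 1) (entry (q (m + 1)) m)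
  have hp (i m : ℕ) (hm : m < (q i).length) : h i (entry (q i) m) = p m := by
    rw [hmove i _ m (le_max_left i (m + 1)) hm]
    exact (hmove (m + 1) _ m (le_max_right i (m + 1)) (hlen (m + 1))).symm
  have hinj : Function.Injective p := by
    intro m m' hmm
    have h1 := hlen (max m m' + 1)
    have hm : m < (q (max m m' + 1)).length := by omega
    have hm' : m' < (q (max m m' + 1)).length := by omega
    rw [← hp _ m hm, ← hp _ m' hm'] at hmm
    have := (h _).injective hmm
    rw [entry_of_lt hm, entry_of_lt hm'] at this
    exact (List.Nodup.getElem_inj_iff (hnd _)).1 this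
  have hsurj : Function.Surjective p := by
    intro z
    obtain ⟨i, x, rfl⟩ := hQ z
    obtain ⟨j, hij, hj⟩ := hcov i x
    obtain ⟨m, hm, hmx⟩ := List.mem_iff_getElem.1 hj
    refine ⟨m, ?_⟩
    rw [← hp j m hm, entry_of_lt hm, hmx, hh i j hij]
  exact ⟨Q, _, h, Equiv.ofBijective p ⟨hinj, hsurj⟩, hh, hQ, hp⟩

/-- The structure that makes a bijection with a structure an isomorphism. -/
theorem exists_structure_equiv {Q : Type*} [L.Structure Q] (p : ℕ ≃ Q) :
    ∃ B : L.Structure ℕ, Nonempty (ℕ ≃[L] Q) ∧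
      ∀ φ : AtomicSentence L, φ.Holds B ↔ φ.Realize p := by
  let := Equiv.inducedStructure (L := L) p.symm
  let e : ℕ ≃[L] Q := (Equiv.inducedStructureEquiv p.symm).symm
  refine ⟨inferInstance, ⟨e⟩, fun φ => ?_⟩
  rw [AtomicSentence.holds_iff_realize]
  exact (AtomicSentence.realize_equiv e id φ).symm

end Limit

end IndexSets

/-! ### The upper bound: the index set is `Σ⁰₃(X)` -/

namespace IndexSets

open FirstOrder Language

variable {L : FirstOrder.Language.{u, v}}

theorem exists_generating_list [L.Structure ℕ] (h : Structure.FG L ℕ) :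
    ∃ a : List ℕ, a ≠ [] ∧ ∀ x, ∃ t : L.Term ℕ, t.realize (entry a) = x := by
  obtain ⟨S, hS, hcl⟩ := Structure.fg_iff.1 h
  -- The extra generator 0 only serves to make the list nonempty, as `entry_map` requires.
  refine ⟨0 :: hS.toFinset.toList, by simp, fun x => ?_⟩
  have hx : x ∈ Substructure.closure L S := hcl ▸ Substructure.mem_top x
  obtain ⟨t, rfl⟩ := Substructure.mem_closure_iff_exists_term.1 hx
  have hidx (s : S) : ∃ m, entry (0 :: hS.toFinset.toList) m = s := by
    obtain ⟨m, hm, hms⟩ := List.mem_iff_getElem.1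
      (List.mem_cons_of_mem 0 (show (s : ℕ) ∈ hS.toFinset.toList by simp))
    exact ⟨m, by rw [entry_of_lt hm, hms]⟩
  choose idx hidx using hidx
  refine ⟨t.relabel idx, ?_⟩
  rw [Term.realize_relabel]
  congr 1
  funext s
  exact hidx s

theorem holds_iff_realize_equiv {Q : Type*} [L.Structure Q] {B : L.Structure ℕ}
    (j : @Language.Equiv L ℕ Q B _) (φ : AtomicSentence L) : φ.Holds B ↔ φ.Realize j := by
  rw [AtomicSentence.holds_iff_realize]
  exact (AtomicSentence.realize_equiv j id φ).symm

theorem _root_.ComputableIn.comp_primrec {α β γ : Type*} [Primcodable α] [Primcodable β]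
    [Primcodable γ] {O : Set (ℕ →. ℕ)} {f : β → γ} {g : α → β} (hf : ComputableIn O f)
    (hg : Primrec g) : ComputableIn O fun a => f (g a) := by
  refine (Nat.RecursiveIn.comp hf (hg.computableIn (O := O))).of_eq fun n => ?_
  cases (Encodable.decode n : Option α) with
  | none =>
    simp only [Part.coe_none, Part.bind_none]
    exact Part.bind_none _
  | some a =>
    simp only [Part.coe_some, Part.bind_some, Part.map_some]
    refine (part_some_bind _ _).trans ?_
    simp

variable [Encodable ((n : ℕ) × L.Functions n)] [Encodable ((n : ℕ) × L.Relations n)]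

/-- The number of the equation between the term with number `w` and the number `x`. -/
def eqCode (w x : ℕ) : ℕ := 2 * Nat.pair w (Encodable.encode [2 * x])

@[fun_prop]
theorem primrec_eqCode {α : Type*} [Primcodable α] {f g : α → ℕ}
    (hf : Primrec f) (hg : Primrec g) : Primrec fun a => eqCode (f a) (g a) := by
  unfold eqCode
  fun_prop

theorem eqCode_relabel (q : List ℕ) (t : L.Term ℕ) (x : ℕ) :
    eqCode (substTerm q (Encodable.encode t)) x =
      (AtomicSentence.equal (t.relabel (entry q)) (.var x)).code := by
  rw [← encode_relabel, eqCode, AtomicSentence.code, encode_term (.var x)]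
  simp [Term.listEncode]

/-- The term with number `w` has value `x` when the numbers are replaced by the entries of `a`. -/
def TermValue (B : L.Structure ℕ) (a : List ℕ) (w x : ℕ) : Prop :=
  TrueCode B (2 * Nat.pair w w) ∧ TrueCode B (eqCode (substTerm a w) x)

/-- The first conjunct of `TermValue` is the trivial equation of `w` with itself, which is a true
sentence exactly when `w` is the number of a term. -/
theorem termValue_iff [B : L.Structure ℕ] {a : List ℕ} {w x : ℕ} :
    TermValue B a w x ↔
      ∃ t : L.Term ℕ, Encodable.encode t = w ∧ t.realize (entry a) = x := by
  have key (t : L.Term ℕ) : TrueCode B (eqCode (substTerm a (Encodable.encode t)) x) ↔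
      t.realize (entry a) = x := by
    rw [eqCode_relabel, trueCode_code]
    simp [AtomicSentence.Holds]
  constructor
  · rintro ⟨h1, h2⟩
    obtain ⟨φ, hφ, -⟩ := trueCode_iff.1 h1
    cases φ with
    | equal t s =>
      simp only [AtomicSentence.code] at hφ
      obtain ⟨rfl, -⟩ := Nat.pair_eq_pair.1 (Nat.eq_of_mul_eq_mul_left two_pos hφ)
      exact ⟨t, rfl, (key t).1 h2⟩
    | rel R ts =>
      simp only [AtomicSentence.code] at hφ
      omega
  · rintro ⟨t, rfl, h⟩
    exact ⟨trueCode_iff.2 ⟨.equal t t, rfl, rfl⟩, (key t).2 h⟩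

theorem reIn_termValue {X : Set ℕ} {B : L.Structure ℕ}
    (hB : ComputableIn (oracleOf X) (charFun (atomicDiagram B))) {α : Type*} [Primcodable α]
    {a : α → List ℕ} {w x : α → ℕ} (ha : Primrec a) (hw : Primrec w) (hx : Primrec x) :
    REIn X fun y => TermValue B (a y) (w y) (x y) :=
  .and (reIn_trueCode hB (by fun_prop)) (reIn_trueCode hB (by fun_prop))

theorem DiagramValue.realize [B : L.Structure ℕ] {q : List ℕ} {φ : AtomicSentence L}
    (h : DiagramValue B q (2 * φ.code) 1) : φ.Realize (entry q) := by
  obtain ⟨d, ⟨h1, h2⟩ | ⟨h1, -⟩⟩ := h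
  · obtain rfl : φ.code = d := by omega
    rcases h2 with ⟨-, -, h2⟩ | ⟨h2, -⟩
    · exact trueCode_substCode.1 h2
    · omega
  · omega

/-- The list `u` is a finite part of an isomorphism to `B` from the structure whose diagram is
given by the `e`-th machine; it sends `b` to `a` and settles everything below `z`. -/
def PartialIso (X : Set ℕ) (B : L.Structure ℕ) (a : List ℕ) (e : ℕ) (b : List ℕ) (z : ℕ)
    (u : List ℕ) : Prop :=
  z < u.length ∧ u.Nodup ∧ (∀ x < z + 1, x ∈ u) ∧ b.map (entry u) = a ∧
    (∀ i < u.length, ∃ w, TermValue B a w (entry u i) ∧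
      1 ∈ Phi X e (2 * eqCode (substTerm b w) i)) ∧
    ∀ c < z + 1, ∃ v, DiagramValue B u c v ∧ v ∈ Phi X e c

theorem reIn_partialIso {X : Set ℕ} {B : L.Structure ℕ}
    (hB : ComputableIn (oracleOf X) (charFun (atomicDiagram B))) (a : List ℕ) :
    REIn X fun x : (ℕ × List ℕ × ℕ) × List ℕ => PartialIso X B a x.1.1 x.1.2.1 x.1.2.2 x.2 := by
  unfold PartialIso
  refine .and (by fun_prop) (.and (by fun_prop) (.and (.forall_lt (by fun_prop) (by fun_prop))
    (.and (by fun_prop) (.and (.forall_lt (by fun_prop) (.exists' (.and ?_ ?_)))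
    (.forall_lt (by fun_prop) (.exists' (.and ?_ ?_)))))))
  · exact reIn_termValue hB (by fun_prop) (by fun_prop) (by fun_prop)
  · exact reIn_mem_Phi.comp
      (f := fun y : (((ℕ × List ℕ × ℕ) × List ℕ) × ℕ) × ℕ =>
        (y.1.1.1.1, 2 * eqCode (substTerm y.1.1.1.2.1 y.2) y.1.2, 1)) (by fun_prop)
  · exact reIn_diagramValue hB (by fun_prop) (by fun_prop) (by fun_prop)
  · exact reIn_mem_Phi.comp
      (f := fun y : (((ℕ × List ℕ × ℕ) × List ℕ) × ℕ) × ℕ => (y.1.1.1.1, y.1.2, y.2))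
      (by fun_prop)

theorem exists_partialIso {X : Set ℕ} {B : L.Structure ℕ} [S : L.Structure ℕ] {a : List ℕ} {e : ℕ}
    (hgen : ∀ x, ∃ t : L.Term ℕ, t.realize (entry a) = x) (ha : a ≠ [])
    (hB : GivesDiagram X e B) (j : ℕ ≃ ℕ)
    (hj : ∀ φ : AtomicSentence L, φ.Holds B ↔ φ.Realize j) (z : ℕ) :
    ∃ u, PartialIso X S a e (a.map j.symm) z u := by
  -- The list tabulates `j` below `N`. A list's code exceeds its entries, so `N` lies above the
  -- preimages of the generators and of all numbers up to `z`.
  let N := max (z + 1) (max (Encodable.encode (a.map j.symm))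
    (Encodable.encode ((List.range (z + 1)).map j.symm)))
  have hlen : ((List.range N).map j).length = N := by simp
  have hu (m : ℕ) (hm : m < N) : entry ((List.range N).map j) m = j m := by
    rw [entry_of_lt (by simpa using hm)]
    simp
  have hba : (a.map j.symm).map (fun m => j m) = a := by
    simp
  refine ⟨(List.range N).map j, ?_, ?_, fun x hx => ?_, ?_, fun i hi => ?_, fun c hc => ?_⟩
  · rw [hlen]
    exact lt_of_lt_of_le (Nat.lt_succ_self z) (le_max_left _ _)
  · exact List.Nodup.map j.injective List.nodup_range
  · refine List.mem_map.2 ⟨j.symm x, List.mem_range.2 ?_, by simp⟩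
    refine lt_of_lt_of_le (lt_encode_of_mem (List.mem_map.2 ⟨x, List.mem_range.2 hx, rfl⟩)) ?_
    exact (le_max_right _ _).trans (le_max_right _ _)
  · refine Eq.trans (List.map_congr_left fun m hm => hu m ?_) hba
    exact (lt_encode_of_mem hm).trans_le ((le_max_left _ _).trans (le_max_right _ _))
  · rw [hlen] at hi
    obtain ⟨t, ht⟩ := hgen (j i)
    refine ⟨Encodable.encode t, termValue_iff.2 ⟨t, rfl, by rw [hu i hi, ht]⟩, ?_⟩
    rw [hB, eqCode_relabel, Part.mem_some_iff, charFun_apply, if_pos]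
    change TrueCode B _
    rw [trueCode_code, hj]
    simp only [AtomicSentence.Realize, Term.realize_relabel, Term.realize_var]
    rw [← ht]
    congr 1
    funext m
    rw [Function.comp_apply, ← entry_map j (by simpa using ha), hba]
  · refine ⟨charFun (atomicDiagram B) c, (diagramValue_iff fun φ hφ => ?_).2 rfl, ?_⟩
    · rw [hj]
      refine AtomicSentence.realize_congr_code fun m hm => (hu m ?_).symm
      have := le_max_left (z + 1) (max (Encodable.encode (a.map j.symm))
        (Encodable.encode ((List.range (z + 1)).map j.symm)))
      omega
    · rw [hB]
      exact Part.mem_some _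

/-- The lists chosen for different `z` are unrelated, but they converge pointwise and the limit is
the isomorphism: `i` is named by a term in `b`, every late list respects that equation, and all
lists send `b` to `a`. -/
theorem exists_equiv_of_partialIso {X : Set ℕ} [S : L.Structure ℕ] {a b : List ℕ} {e : ℕ}
    (ha : a ≠ []) (h : ∀ z, ∃ u, PartialIso X S a e b z u) :
    ∃ B : L.Structure ℕ, GivesDiagram X e B ∧ Nonempty (@Language.Equiv L ℕ ℕ B S) := by
  choose u hlen hnd hcov hba hterm hdiag using h
  have hb : b ≠ [] := by
    rintro rfl
    exact ha (hba 0).symm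
  have hlim (z i : ℕ) (hi : i < (u z).length) :
      ∃ Z, ∀ z', Z ≤ z' → entry (u z') i = entry (u z) i := by
    obtain ⟨w, hw, h1⟩ := hterm z i hi
    obtain ⟨t, rfl, ht⟩ := termValue_iff.1 hw
    -- From this bound on, the naming equation is among the sentences on which the list must agree
    -- with the machine.
    refine ⟨2 * eqCode (substTerm b (Encodable.encode t)) i, fun z' hz' => ?_⟩
    obtain ⟨v, hv, hv'⟩ := hdiag z' _ (Nat.lt_succ_of_le hz')
    rw [Part.mem_unique hv' h1, eqCode_relabel] at hv
    have := hv.realize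
    simp only [AtomicSentence.Realize, Term.realize_relabel, Term.realize_var] at this
    rw [← this, ← ht]
    congr 1
    funext m
    rw [Function.comp_apply, ← entry_map (entry (u z')) hb, hba]
  let p (i : ℕ) : ℕ := entry (u i) i
  -- Each entry already equals the eventual value, so any two lists agree wherever both have an
  -- entry.
  have hp (z i : ℕ) (hi : i < (u z).length) : entry (u z) i = p i := by
    obtain ⟨Z, hZ⟩ := hlim z i hi
    obtain ⟨Z', hZ'⟩ := hlim i i (hlen i)
    rw [← hZ (max Z Z') (le_max_left _ _), hZ' (max Z Z') (le_max_right _ _)]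
  have hinj : Function.Injective p := by
    intro m m' hmm
    have h1 := hlen (max m m')
    have hm : m < (u (max m m')).length := by omega
    have hm' : m' < (u (max m m')).length := by omega
    rw [← hp _ m hm, ← hp _ m' hm', entry_of_lt hm, entry_of_lt hm'] at hmm
    exact (List.Nodup.getElem_inj_iff (hnd _)).1 hmm
  have hsurj : Function.Surjective p := by
    intro x
    obtain ⟨m, hm, hmx⟩ := List.mem_iff_getElem.1 (hcov x x (Nat.lt_succ_self x))
    exact ⟨m, by rw [← hp x m hm, entry_of_lt hm, hmx]⟩
  have hcongr (c : ℕ) (φ : AtomicSentence L) (hφ : φ.code = c / 2) :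
      φ.Realize p ↔ φ.Realize (entry (u c)) := by
    refine AtomicSentence.realize_congr_code fun m hm => (hp c m ?_).symm
    have := hlen c
    omega
  obtain ⟨B, hB, hφB⟩ := exists_structure_equiv (L := L) (Equiv.ofBijective p ⟨hinj, hsurj⟩)
  refine ⟨B, fun c => ?_, hB⟩
  obtain ⟨v, hv, hv'⟩ := hdiag c c (Nat.lt_succ_self c)
  rw [Part.eq_some_iff.2 hv', Part.some_inj, eq_comm]
  exact (diagramValue_iff fun φ hφ => (hφB φ).trans (hcongr c φ hφ)).1 hv

theorem isSigma3_indexSet {X : Set ℕ} {A : Type w} [L.Structure A] (hfg : Structure.FG L A)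
    (hA : XComputable X L A) : IsSigma3 X (indexSet X L A) := by
  obtain ⟨S, hS, ⟨i⟩⟩ := hA
  let i' := i.symm
  obtain ⟨a, ha, hgen⟩ := exists_generating_list ((Equiv.fg_iff i).2 hfg)
  obtain ⟨R, hR, h⟩ := (REIn.exists'
    (p := fun (x : ℕ × List ℕ × ℕ) u => PartialIso X S a x.1 x.2.1 x.2.2 u) (reIn_partialIso hS a)).exists_computableIn
  -- The three quantifiers range over the proposed generators, the bound, and the search for a
  -- partial isomorphism.
  refine ⟨fun n b z c => R (n, Denumerable.ofNat (List ℕ) b, z) c,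
    hR.comp_primrec (g := fun p : ℕ × ℕ × ℕ × ℕ =>
      ((p.1, Denumerable.ofNat (List ℕ) p.2.1, p.2.2.1), p.2.2.2)) (by fun_prop), fun n => ?_⟩
  have h' (n b z : ℕ) := h (n, Denumerable.ofNat (List ℕ) b, z)
  simp only [← h']
  constructor
  · rintro ⟨B, hB, ⟨j⟩⟩
    let j' : @Language.Equiv L ℕ ℕ B S := @Language.Equiv.comp L ℕ A B _ ℕ S i' j
    let j₀ : ℕ ≃ ℕ := @Language.Equiv.toEquiv L ℕ ℕ B S j'
    refine ⟨Encodable.encode (a.map j₀.symm), fun z => ?_⟩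
    rw [Denumerable.ofNat_encode]
    exact @exists_partialIso L _ _ X B S a n hgen ha hB j₀
      (@holds_iff_realize_equiv L ℕ S B j') z
  · rintro ⟨b, hb⟩
    obtain ⟨B, hB, ⟨j⟩⟩ := exists_equiv_of_partialIso ha hb
    exact ⟨B, hB, ⟨@Language.Equiv.comp L ℕ ℕ B S A _ i j⟩⟩

end IndexSets

namespace IndexSets

open FirstOrder Language

/-! ### Levels -/

/-- From level `k`, the move at stage `s` is to the least level at most `k` for which an event
occurs, and to `k + 1` if there is none. -/
def NextLevel (ev : ℕ → ℕ → Prop) (s k k' : ℕ) : Prop :=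
  k' ≤ k + 1 ∧ (k' = k + 1 ∨ ev k' s) ∧ ∀ j < k', ¬ ev j s

theorem exists_nextLevel (ev : ℕ → ℕ → Prop) (s k : ℕ) : ∃ k', NextLevel ev s k k' := by
  classical
  have h : ∃ j, j = k + 1 ∨ ev j s := ⟨k + 1, .inl rfl⟩
  exact ⟨Nat.find h, Nat.find_min' h (.inl rfl), Nat.find_spec h,
    fun j hj hev => Nat.find_min h hj (.inr hev)⟩

section Levels

variable {ev : ℕ → ℕ → Prop} {k : ℕ → ℕ} (hk : ∀ s, NextLevel ev s (k s) (k (s + 1)))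
include hk

/-- Once the finitely many events below `a` are over, a move to a level below `a` can only be a
rise; so `a` is reached within `a` stages and never left downwards. -/
theorem eventually_le_level {a : ℕ} (ha : ∀ j < a, {s | ev j s}.Finite) :
    ∃ N, ∀ s, N ≤ s → a ≤ k s := by
  obtain ⟨N, hN⟩ : ∃ N, ∀ s, N ≤ s → ∀ j < a, ¬ ev j s := by
    have hfin : (⋃ j ∈ Set.Iio a, {s | ev j s}).Finite :=
      (Set.finite_Iio a).biUnion fun j hj => ha j hj
    obtain ⟨N, hN⟩ := hfin.bddAbove
    refine ⟨N + 1, fun s hs j hj hev => ?_⟩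
    have : s ≤ N := hN (Set.mem_biUnion (show j ∈ Set.Iio a from hj) hev)
    omega
  have h (i : ℕ) : i ≤ k (N + i) ∨ a ≤ k (N + i) := by
    induction i with
    | zero => exact .inl (Nat.zero_le _)
    | succ i ih =>
      obtain ⟨h1, h2, -⟩ := hk (N + i)
      have h3 := hN (N + i) (by omega)
      rw [← add_assoc]
      by_contra hc
      rw [not_or, not_le, not_le] at hc
      rcases h2 with h2 | h2
      · omega
      · exact h3 _ hc.2 h2
  refine ⟨N + a, fun s hs => ?_⟩
  obtain ⟨i, rfl⟩ := Nat.exists_eq_add_of_le (show N ≤ s by omega)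
  rcases h i with h | h <;> omega

/-- The limit inferior of the level is the least event that recurs. -/
theorem exists_recurrent_level (h : ∃ a, {s | ev a s}.Infinite) :
    ∃ a N, (∀ s, N ≤ s → a ≤ k s) ∧ ∀ m, ∃ s, m ≤ s ∧ k s = a := by
  classical
  have hmin (j : ℕ) (hj : j < Nat.find h) : {s | ev j s}.Finite :=
    Set.not_infinite.1 (Nat.find_min h hj)
  obtain ⟨N, hN⟩ := eventually_le_level hk hmin
  refine ⟨Nat.find h, N, hN, fun m => ?_⟩
  obtain ⟨s, hs, hms⟩ := (Nat.find_spec h).exists_gt (max m N)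
  -- An event `a` at stage `s` shows in the level at `s + 1`.
  refine ⟨s + 1, by omega, le_antisymm ?_ (hN _ (by omega))⟩
  by_contra hc
  exact (hk s).2.2 _ (not_le.1 hc) hs

end Levels

/-! ### Stacks of finite approximations -/

section Stack

/-- The entry of the stack `T` at level `j`. -/
def lev (T : List (List ℕ)) (j : ℕ) : List ℕ := T.getD j []

/-- The entry of the stack `T` at its highest level. -/
def top (T : List (List ℕ)) : List ℕ := lev T (T.length - 1)

@[fun_prop]
theorem primrec_lev {α : Type*} [Primcodable α] {f : α → List (List ℕ)} {g : α → ℕ}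
    (hf : Primrec f) (hg : Primrec g) : Primrec fun a => lev (f a) (g a) := by
  unfold lev
  fun_prop

@[fun_prop]
theorem primrec_top {α : Type*} [Primcodable α] {f : α → List (List ℕ)}
    (hf : Primrec f) : Primrec fun a => top (f a) := by
  unfold top
  fun_prop

theorem lev_take_append {T : List (List ℕ)} {k : ℕ} {q : List ℕ} (hk : k ≤ T.length) {j : ℕ}
    (hj : j < k) : lev (T.take k ++ [q]) j = lev T j := by
  have h : j < (T.take k).length := by simp; omega
  simp only [lev, List.getD_eq_getElem?_getD]
  rw [List.getElem?_append_left h, List.getElem?_take_of_lt hj]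

theorem top_append_singleton (T : List (List ℕ)) (q : List ℕ) : top (T ++ [q]) = q := by
  simp [top, lev]

/-- The image of `r` under `g` is an initial segment of `q`. -/
def MapPrefix (g : ℕ → ℕ) (r q : List ℕ) : Prop :=
  r.length ≤ q.length ∧ ∀ i < r.length, g (entry r i) = entry q i

/-- `MapPrefix` uses `g` only through its graph, which suits enumerability; the prefix form is the
one that composes. -/
theorem mapPrefix_iff {g : ℕ → ℕ} {r q : List ℕ} : MapPrefix g r q ↔ r.map g <+: q := by
  constructor
  · rintro ⟨h1, h2⟩
    rw [List.prefix_iff_getElem]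
    refine ⟨by simpa using h1, fun i hi => ?_⟩
    have hi' : i < r.length := by simpa using hi
    have := h2 i hi'
    rw [entry_of_lt hi', entry_of_lt (hi'.trans_le h1)] at this
    simpa using this
  · intro h
    have hl : r.length ≤ q.length := by simpa using h.length_le
    refine ⟨hl, fun i hi => ?_⟩
    rw [← entry_map g (List.ne_nil_of_length_pos (by omega)),
      entry_of_prefix h (by simpa using hi)]

theorem exists_extension {q : List ℕ} (hq : q.Nodup) (l : List ℕ) :
    ∃ q', q <+: q' ∧ q'.Nodup ∧ ∀ x ∈ l, x ∈ q' := by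
  induction l with
  | nil => exact ⟨q, List.prefix_rfl, hq, by simp⟩
  | cons a l ih =>
    obtain ⟨q', h1, h2, h3⟩ := ih
    by_cases ha : a ∈ q'
    · exact ⟨q', h1, h2, List.forall_mem_cons.2 ⟨ha, h3⟩⟩
    · refine ⟨q' ++ [a], h1.trans (List.prefix_append _ _), ?_, List.forall_mem_cons.2
        ⟨by simp, fun x hx => List.mem_append_left _ (h3 x hx)⟩⟩
      rw [List.nodup_append]
      refine ⟨h2, List.nodup_singleton a, ?_⟩
      rintro x hx y hy rfl
      exact ha (List.mem_singleton.1 hy ▸ hx)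

/-- What the construction preserves. -/
structure StackInv (g : ℕ → ℕ) (s : ℕ) (T : List (List ℕ)) : Prop where
  length_pos : 0 < T.length
  length_le : T.length ≤ s + 1
  map_prefix : ∀ j, j + 1 < T.length → (lev T j).map g <+: lev T (j + 1)
  nodup : (top T).Nodup
  le_length : s ≤ (top T).length

theorem stackInv_zero (g : ℕ → ℕ) : StackInv g 0 [List.nil] := by
  constructor <;> simp [top, lev]

theorem StackInv.map_iterate_prefix {g : ℕ → ℕ} {s : ℕ} {T : List (List ℕ)}
    (hT : StackInv g s T) {i j : ℕ} (hij : i ≤ j)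
    (hj : j < T.length) : (lev T i).map g^[j - i] <+: lev T j := by
  induction j, hij using Nat.le_induction with
  | base => simp
  | succ j hij ih =>
    have h := (ih (by omega)).map g
    rw [List.map_map, ← Function.iterate_succ', ← Nat.succ_sub hij] at h
    exact h.trans (hT.map_prefix j hj)

variable {L : FirstOrder.Language.{u, v}}
variable [Encodable ((n : ℕ) × L.Functions n)] [Encodable ((n : ℕ) × L.Relations n)]

/-- The lists `q` and `r` satisfy the same atomic sentences with numbers below `s`. -/
def Agree (B : L.Structure ℕ) (s : ℕ) (q r : List ℕ) : Prop :=
  ∀ d < s, (¬ TrueCode B d ∧ ¬ FalseCode B d) ∨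
    (TrueCode B (substCode q d) ∧ TrueCode B (substCode r d)) ∨
    (FalseCode B (substCode q d) ∧ FalseCode B (substCode r d))

theorem agree_iff [B : L.Structure ℕ] {s : ℕ} {q r : List ℕ} :
    Agree B s q r ↔ ∀ φ : AtomicSentence L, φ.code < s →
      (φ.Realize (entry q) ↔ φ.Realize (entry r)) := by
  constructor
  · intro h φ hφ
    rcases h _ hφ with h | h | h
    · exact absurd (trueCode_or_falseCode.2 ⟨φ, rfl⟩) (by rwa [not_or])
    · rw [trueCode_substCode, trueCode_substCode] at h
      exact iff_of_true h.1 h.2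
    · rw [falseCode_substCode, falseCode_substCode] at h
      exact iff_of_false h.1 h.2
  · intro h d hd
    by_cases hφ : TrueCode B d ∨ FalseCode B d
    · obtain ⟨φ, rfl⟩ := trueCode_or_falseCode.1 hφ
      rw [trueCode_substCode, trueCode_substCode, falseCode_substCode, falseCode_substCode]
      have : φ.Realize (entry q) ↔ φ.Realize (entry r) := h φ hd
      change _ ∨ (φ.Realize (entry q) ∧ φ.Realize (entry r)) ∨
        (¬ φ.Realize (entry q) ∧ ¬ φ.Realize (entry r))
      tauto
    · exact .inl (not_or.1 hφ)

/-- One stage of the construction: the stack `T` is cut down to the new level, and a list is put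
on top that extends the previous one at this level and describes the same finite part of a
structure as the top of `T`. -/
def Step (B : L.Structure ℕ) (g : ℕ → ℕ) (ev : ℕ → ℕ → Prop) (s : ℕ) (T T' : List (List ℕ)) :
    Prop :=
  ∃ k q, T' = T.take k ++ [q] ∧ NextLevel ev s (T.length - 1) k ∧ q.Nodup ∧
    (T.length ≤ k ∨ lev T k <+: q) ∧ (k = 0 ∨ MapPrefix g (lev T (k - 1)) q) ∧
    (∀ j < s + 2, ∀ x < s + 2, ∃ y, y ∈ q ∧ g^[j] x = y) ∧ Agree B s (top T) q

theorem le_length_of_forall_mem {q : List ℕ} {n : ℕ} (h : ∀ x < n, x ∈ q) : n ≤ q.length := by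
  have h1 : Finset.range n ⊆ q.toFinset := fun x hx => by
    rw [List.mem_toFinset]
    exact h x (Finset.mem_range.1 hx)
  have h2 := Finset.card_le_card h1
  rw [Finset.card_range] at h2
  exact h2.trans (List.toFinset_card_le q)

section Step

variable [B : L.Structure ℕ] {g : ℕ ↪[L] ℕ} {ev : ℕ → ℕ → Prop} {s : ℕ} {T T' : List (List ℕ)}

theorem Step.nextLevel (h : Step B g ev s T T') (hT : 0 < T.length) :
    NextLevel ev s (T.length - 1) (T'.length - 1) := by
  obtain ⟨k, q, rfl, h1, -⟩ := h
  have hk : k ≤ T.length := by have := h1.1; omega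
  simpa [Nat.min_eq_left hk] using h1

theorem Step.stackInv (h : Step B g ev s T T') (hT : StackInv g s T) : StackInv g (s + 1) T' := by
  obtain ⟨k, q, rfl, h1, h2, h3, h4, h5, h6⟩ := h
  have hpos := hT.length_pos
  have hk : k ≤ T.length := by have := h1.1; omega
  have hlen : (T.take k ++ [q]).length = k + 1 := by simp [hk]
  refine ⟨by omega, by have := hT.length_le; omega, fun j hj => ?_, ?_, ?_⟩
  · rw [hlen] at hj
    rcases Nat.lt_or_ge (j + 1) k with hjk | hjk
    · rw [lev_take_append hk hjk, lev_take_append hk (by omega)]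
      exact hT.map_prefix j (by omega)
    · obtain rfl : k = j + 1 := by omega
      have h7 : lev (T.take (j + 1) ++ [q]) (j + 1) = q := by
        have := top_append_singleton (T.take (j + 1)) q
        rwa [top, hlen] at this
      rw [h7, lev_take_append hk (by omega)]
      rcases h4 with h4 | h4
      · omega
      · exact mapPrefix_iff.1 h4
  · rwa [top_append_singleton]
  · rw [top_append_singleton]
    refine le_length_of_forall_mem fun x hx => ?_
    obtain ⟨y, hy, rfl⟩ := h5 0 (by omega) x (by omega)
    exact hy

/-- A rise applies `g` to the top list. For any other move to level `k`, the top list extends an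
iterated image of the list kept at `k`, and `Σ⁰₁`-elementarity of that iterate moves the remaining
entries back while preserving the promised diagram. -/
theorem StackInv.exists_step (hg : IsSigmaOneElementary g) (hT : StackInv g s T) :
    ∃ T', Step B g ev s T T' := by
  obtain ⟨k, hk⟩ := exists_nextLevel ev s (T.length - 1)
  have hpos := hT.length_pos
  obtain ⟨q₀, h1, h2, h3, h4, h5⟩ : ∃ q₀ : List ℕ, q₀.length = (top T).length ∧ q₀.Nodup ∧
      (T.length ≤ k ∨ lev T k <+: q₀) ∧ (k = 0 ∨ (lev T (k - 1)).map g <+: q₀) ∧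
      ∀ φ : AtomicSentence L, φ.code < s →
        (φ.Realize (entry (top T)) ↔ φ.Realize (entry q₀)) := by
    rcases Nat.lt_or_ge k T.length with hlt | hge
    · have hpre := hT.map_iterate_prefix (i := k) (j := T.length - 1) (by omega) (by omega)
      let v (m : ℕ) : ℕ := if m < (top T).length then entry (top T) m else 0
      -- The equations between named elements are added so that the list found below has no
      -- repetitions.
      let Φ : Set (AtomicSentence L) := {φ | φ.code < s} ∪
        (fun x : ℕ × ℕ => AtomicSentence.equal (.var x.1) (.var x.2)) ''
          (Set.Iio (top T).length ×ˢ Set.Iio (top T).length)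
      have hΦ : Φ.Finite := by
        refine Set.Finite.union ?_ (Set.Finite.image _ ((Set.finite_Iio _).prod (Set.finite_Iio _)))
        exact Set.Finite.preimage AtomicSentence.code_injective.injOn (Set.finite_Iio s)
      have hl : (lev T k).length ≤ (top T).length := by
        simpa [top] using hpre.length_le
      obtain ⟨v', hv', hΦv⟩ := (hg.iter (T.length - 1 - k)).exists_realize_iff hl (entry (lev T k)) v
        (fun i hi => by
          simp only [v, if_pos (hi.trans_le hl), coe_iterEmbedding]
          rw [← entry_map g^[T.length - 1 - k] (List.ne_nil_of_length_pos (by omega))]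
          exact entry_of_prefix hpre (by simpa using hi))
        (fun m hm => by simp [v, not_lt.2 hm]) hΦ
      have he (m : ℕ) (hm : m < (top T).length) :
          entry ((List.range (top T).length).map v') m = v' m := by
        rw [entry_of_lt (by simpa using hm)]
        simp
      have hpk : lev T k <+: (List.range (top T).length).map v' := by
        have := (mapPrefix_iff (g := id) (r := lev T k)
          (q := (List.range (top T).length).map v')).1
          ⟨by simpa using hl, fun i hi => by rw [he i (hi.trans_le hl), hv' i hi]; rfl⟩
        simpa using this
      refine ⟨(List.range (top T).length).map v', by simp, ?_, .inr hpk, ?_, fun φ hφ => ?_⟩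
      · refine List.Nodup.map_on (fun i hi j hj hij => ?_) List.nodup_range
        rw [List.mem_range] at hi hj
        have h6 := hΦv (.equal (.var i) (.var j)) (.inr ⟨(i, j), ⟨hi, hj⟩, rfl⟩)
        simp only [AtomicSentence.Realize, Term.realize_var, v, if_pos hi, if_pos hj] at h6
        have h7 := h6.2 hij
        rw [entry_of_lt hi, entry_of_lt hj] at h7
        exact hT.nodup.getElem_inj_iff.1 h7
      · rcases Nat.eq_zero_or_pos k with h0 | h0
        · exact .inl h0
        · have := hT.map_prefix (k - 1) (by omega)
          rw [Nat.sub_add_cancel h0] at this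
          exact .inr (this.trans hpk)
      · have hs := hT.le_length
        rw [AtomicSentence.realize_congr_code (v' := v) fun m hm => by
            simp only [v]; rw [if_pos (by omega)],
          AtomicSentence.realize_congr_code (v := entry ((List.range (top T).length).map v'))
            (v' := v') fun m hm => he m (by omega)]
        exact hΦv φ (.inl hφ)
    · have hkT : k = T.length := by have := hk.1; omega
      refine ⟨(top T).map g, by simp, hT.nodup.map g.injective, .inl hge, .inr ?_, fun φ hφ => ?_⟩
      · rw [hkT]
        exact List.prefix_rfl
      · have hs := hT.le_length
        have : entry ((top T).map g) = g ∘ entry (top T) :=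
          funext fun m => entry_map g (List.ne_nil_of_length_pos (by omega)) m
        rw [this, AtomicSentence.realize_embedding]
  -- Further elements are appended to make the limit exhaust everything. The promised sentences
  -- mention only earlier positions, so agreement is untouched.
  obtain ⟨q, h6, h7, h8⟩ := exists_extension h2
    ((List.range (s + 2)).flatMap fun j => (List.range (s + 2)).map fun x => g^[j] x)
  have hs := hT.le_length
  refine ⟨_, k, q, rfl, hk, h7, h3.imp_right fun h => h.trans h6,
    h4.imp_right fun h => mapPrefix_iff.2 (h.trans h6), fun j hj x hx => ⟨_, h8 _ ?_, rfl⟩,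
    agree_iff.2 fun φ hφ => (h5 φ hφ).trans ?_⟩
  · exact List.mem_flatMap.2 ⟨j, List.mem_range.2 hj, List.mem_map.2 ⟨x, List.mem_range.2 hx, rfl⟩⟩
  · exact AtomicSentence.realize_congr_code fun m hm => (entry_of_prefix h6 (by omega)).symm

end Step

end Stack

end IndexSets

/-! ### The structure obtained from a run of the construction -/

namespace IndexSets

open FirstOrder Language Filter

variable {L : FirstOrder.Language.{u, v}}

theorem nonempty_equiv_of_surjective {M N : Type*} [L.Structure M] [L.Structure N] (f : M ↪[L] N)
    (hf : Function.Surjective f) : Nonempty (M ≃[L] N) :=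
  ⟨{ Equiv.ofBijective f ⟨f.injective, hf⟩ with
      map_fun' := fun F x => f.map_fun F x
      map_rel' := fun R x => f.map_rel R x }⟩

variable [Encodable ((n : ℕ) × L.Functions n)] [Encodable ((n : ℕ) × L.Relations n)]

section Construction

variable [S : L.Structure ℕ] {g : ℕ ↪[L] ℕ} {ev : ℕ → ℕ → Prop} {T : ℕ → List (List ℕ)}

/-- The level at stage `s`. -/
def levelAt (T : ℕ → List (List ℕ)) (s : ℕ) : ℕ := (T s).length - 1

/-- From stage `t` on, the level is never below its value at `t`. -/
def IsTrueStage (T : ℕ → List (List ℕ)) (t : ℕ) : Prop := ∀ s, t ≤ s → levelAt T t ≤ levelAt T s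

/-- Consecutive top lists agree on all sentences numbered below the stage, so a truth value never
changes once promised, even when the level drops. -/
theorem realize_top_iff (hT : ∀ s, Step S g ev s (T s) (T (s + 1))) {s t : ℕ}
    {φ : AtomicSentence L} (hs : φ.code < s) (hst : s ≤ t) :
    φ.Realize (entry (top (T t))) ↔ φ.Realize (entry (top (T s))) := by
  induction t, hst using Nat.le_induction with
  | base => rfl
  | succ t hst ih =>
    rw [← ih]
    obtain ⟨k, q, h1, -, -, -, -, -, h2⟩ := hT t
    rw [h1, top_append_singleton]
    exact (agree_iff.1 h2 φ (by omega)).symm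

theorem mem_top_of_lt (hT : ∀ s, Step S g ev s (T s) (T (s + 1))) {s j x : ℕ}
    (hs : 0 < s) (hj : j ≤ s) (hx : x ≤ s) :
    g^[j] x ∈ top (T s) := by
  obtain ⟨s, rfl⟩ := Nat.exists_eq_succ_of_ne_zero hs.ne'
  obtain ⟨k, q, h1, -, -, -, -, h2, -⟩ := hT s
  rw [Nat.succ_eq_add_one, h1, top_append_singleton]
  obtain ⟨y, hy, rfl⟩ := h2 j (by omega) x (by omega)
  exact hy

variable (h0 : T 0 = [List.nil]) (hT : ∀ s, Step S g ev s (T s) (T (s + 1)))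

include h0 hT

theorem stackInv_of_step (s : ℕ) : StackInv g s (T s) := by
  induction s with
  | zero => exact h0 ▸ stackInv_zero g
  | succ s ih => exact (hT s).stackInv ih

theorem nextLevel_of_step (s : ℕ) : NextLevel ev s (levelAt T s) (levelAt T (s + 1)) :=
  (hT s).nextLevel (stackInv_of_step h0 hT s).length_pos

/-- After a true stage its level is never cut away: its list is kept while the construction works
higher, and extended when the construction returns. -/
theorem IsTrueStage.top_prefix {t s : ℕ} (ht : IsTrueStage T t) (hts : t ≤ s) :
    top (T t) <+: lev (T s) (levelAt T t) := by
  induction s, hts using Nat.le_induction with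
  | base => exact List.prefix_rfl
  | succ s hts ih =>
    have h1 := ht (s + 1) (by omega)
    have h2 := ht s hts
    have hpos := (stackInv_of_step h0 hT s).length_pos
    obtain ⟨k, q, h3, h4, -, h5, -⟩ := hT s
    have hk : k ≤ (T s).length := by have := h4.1; omega
    have h6 : levelAt T (s + 1) = k := by simp [levelAt, h3, hk]
    rw [h6] at h1
    rcases h1.lt_or_eq with h1 | h1
    · rw [h3, lev_take_append hk h1]
      exact ih
    · have h7 : lev (T (s + 1)) k = q := by
        rw [← h6]
        change top (T (s + 1)) = q
        rw [h3, top_append_singleton]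
      rw [h1, h7]
      rw [h1] at ih
      rcases h5 with h5 | h5
      · simp only [levelAt] at h1 h2
        omega
      · exact ih.trans h5

theorem IsTrueStage.map_top_prefix {t s : ℕ} (ht : IsTrueStage T t) (hts : t ≤ s) :
    (top (T t)).map g^[levelAt T s - levelAt T t] <+: top (T s) := by
  have hpos := (stackInv_of_step h0 hT s).length_pos
  exact ((ht.top_prefix h0 hT hts).map _).trans
    ((stackInv_of_step h0 hT s).map_iterate_prefix (ht s hts) (Nat.sub_lt hpos one_pos))

/-- Along any sequence of true stages, the construction builds a limit of copies of the given
structure. -/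
theorem exists_structure_of_trueStages {t : ℕ → ℕ} (ht : StrictMono t)
    (htrue : ∀ i, IsTrueStage T (t i)) :
    ∃ (Q : Type) (_ : L.Structure Q) (h : ℕ → (ℕ ↪[L] Q)) (B : L.Structure ℕ),
      (∀ i j, i ≤ j → ∀ x, h j (g^[levelAt T (t j) - levelAt T (t i)] x) = h i x) ∧
      (∀ z, ∃ i x, h i x = z) ∧ Nonempty (@Language.Equiv L ℕ Q B _) ∧
      ∀ c v, DiagramValue S (top (T (c + 1))) c v ↔ charFun (atomicDiagram B) c = v := by
  have hinv := stackInv_of_step h0 hT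
  have hlev (s : ℕ) : levelAt T s ≤ s := by
    have := (hinv s).length_le
    simp only [levelAt]
    omega
  obtain ⟨Q, _, h, p, h1, h2, h3⟩ := exists_limit_enumeration g (κ := fun i => levelAt T (t i))
    (q := fun i => top (T (t i)))
    (monotone_nat_of_le_succ fun i => htrue i _ (ht.monotone i.le_succ))
    (fun i j hij => (htrue i).map_top_prefix h0 hT (ht.monotone hij))
    (fun i => (hinv _).nodup) (fun i => (ht.le_apply (x := i)).trans (hinv _).le_length)
    (fun i x => by
      -- The level at a stage is at most the stage, so both the exponent and `x` fall within what
      -- the top list must contain by then.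
      refine ⟨max i x + 1, by omega, mem_top_of_lt hT ?_ ?_ ?_⟩
      · have := ht.le_apply (x := max i x + 1); omega
      · exact (Nat.sub_le _ _).trans (hlev _)
      · have := ht.le_apply (x := max i x + 1); omega)
  -- The sentence behind `c` has number at most `c`, so its truth value is settled by stage `c + 1`.
  have hp (c : ℕ) (φ : AtomicSentence L) (hφ : φ.code = c / 2) :
      φ.Realize p ↔ φ.Realize (entry (top (T (c + 1)))) := by
    have h4 := ht.le_apply (x := c + 1)
    rw [← realize_top_iff hT (φ := φ) (show φ.code < c + 1 by omega) h4,
      ← AtomicSentence.realize_embedding (h (c + 1))]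
    refine AtomicSentence.realize_congr_code fun m hm => (h3 (c + 1) m ?_).symm
    have := (hinv (t (c + 1))).le_length
    omega
  obtain ⟨B, hB, hφB⟩ := exists_structure_equiv (L := L) p
  exact ⟨Q, _, h, B, h1, h2, hB, fun c v =>
    diagramValue_iff fun φ hφ => (hφB φ).trans (hp c φ hφ)⟩

/-- Late stages at the recurrent level are true stages, all at the same level. The connecting maps
are therefore identities, and the first copy is already the whole limit. -/
theorem exists_structure_of_infinite (h : ∃ a, {s | ev a s}.Infinite) :
    ∃ B : L.Structure ℕ, Nonempty (@Language.Equiv L ℕ ℕ S B) ∧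
      ∀ c v, DiagramValue S (top (T (c + 1))) c v ↔ charFun (atomicDiagram B) c = v := by
  obtain ⟨a, N, hN, ha⟩ := exists_recurrent_level (nextLevel_of_step h0 hT) h
  have hfreq : ∃ᶠ s in atTop, N ≤ s ∧ levelAt T s = a := by
    rw [frequently_atTop]
    intro m
    obtain ⟨s, hs, hsa⟩ := ha (max m N)
    exact ⟨s, by omega, by omega, hsa⟩
  obtain ⟨t, ht, hta⟩ := extraction_of_frequently_atTop hfreq
  obtain ⟨Q, hQ, h, B, h1, h2, ⟨e⟩, h3⟩ := exists_structure_of_trueStages h0 hT ht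
    fun i s hs => (hta i).2 ▸ hN s ((hta i).1.trans hs)
  have hsurj : Function.Surjective (h 0) := by
    intro z
    obtain ⟨i, x, rfl⟩ := h2 z
    refine ⟨x, ?_⟩
    rw [← h1 0 i (Nat.zero_le i), (hta i).2, (hta 0).2, Nat.sub_self, Function.iterate_zero, id]
  obtain ⟨e'⟩ := @nonempty_equiv_of_surjective L ℕ Q S hQ (h 0) hsurj
  exact ⟨B, ⟨@Language.Equiv.comp L ℕ Q S hQ ℕ B (@Language.Equiv.symm L ℕ Q B hQ e) e'⟩, h3⟩

/-- Levels tend to infinity, so there are true stages of strictly increasing level. The connecting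
maps are positive iterates of `g`, hence elementary and not surjective. -/
theorem exists_structure_of_finite {A : Type w} [L.Structure A] (e : ℕ ≃[L] A)
    (hg : IsSigmaOneElementary g) (hg' : ¬ Function.Surjective g)
    (h : ∀ a, {s | ev a s}.Finite) :
    ∃ B : L.Structure ℕ, (¬ @Structure.FG L ℕ B ∧ @IsUnionOfSigmaOneChain L ℕ B A _) ∧
      ∀ c v, DiagramValue S (top (T (c + 1))) c v ↔ charFun (atomicDiagram B) c = v := by
  have hlarge (a : ℕ) : ∃ N, ∀ s, N ≤ s → a ≤ levelAt T s :=
    eventually_le_level (nextLevel_of_step h0 hT) fun j _ => h j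
  have hnext (t : ℕ) : ∃ t', t < t' ∧ IsTrueStage T t' ∧ levelAt T t < levelAt T t' := by
    classical
    obtain ⟨N, hN⟩ := hlarge (levelAt T t + 1)
    -- A stage attaining the least level from some point on is a true stage.
    have hex : ∃ k s, max N (t + 1) ≤ s ∧ levelAt T s = k := ⟨_, _, le_rfl, rfl⟩
    obtain ⟨s, hs, hsk⟩ := Nat.find_spec hex
    exact ⟨s, by omega, fun s' hs' => hsk ▸ Nat.find_min' hex ⟨s', hs.trans hs', rfl⟩,
      hN s (by omega)⟩
  choose nxt hn1 hn2 hn3 using hnext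
  -- The shift by one makes every term a value of `nxt`, hence a true stage.
  let t (i : ℕ) : ℕ := nxt^[i + 1] 0
  have htsucc (i : ℕ) : t (i + 1) = nxt (t i) := Function.iterate_succ_apply' nxt (i + 1) 0
  have ht : StrictMono t := strictMono_nat_of_lt_succ fun i => htsucc i ▸ hn1 (t i)
  have htrue (i : ℕ) : IsTrueStage T (t i) := by
    simp only [t, Function.iterate_succ_apply']
    exact hn2 _
  let d (i : ℕ) : ℕ := levelAt T (t (i + 1)) - levelAt T (t i)
  have hd (i : ℕ) : 0 < d i := by
    have := hn3 (t i)
    simp only [d, htsucc]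
    omega
  have hns (i : ℕ) : ¬ Function.Surjective (iterEmbedding g (d i)) := by
    obtain ⟨m, hm⟩ := Nat.exists_eq_succ_of_ne_zero (hd i).ne'
    rw [hm, coe_iterEmbedding, Function.iterate_succ']
    exact fun hs => hg' hs.of_comp
  have hcoe (i x : ℕ) : iterEmbedding g (d i) x = g^[d i] x := by rw [coe_iterEmbedding]
  generalize hG : (fun i => iterEmbedding g (d i)) = G
  have hGn (i : ℕ) : ¬ Function.Surjective (G i) := hG ▸ hns i
  have hGx (i x : ℕ) : G i x = g^[d i] x := hG ▸ hcoe i x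
  have hGσ (i : ℕ) : IsSigmaOneElementary (G i) := hG ▸ hg.iter (d i)
  obtain ⟨Q, hQ, h, B, h1, h2, ⟨e'⟩, h3⟩ := exists_structure_of_trueStages h0 hT ht htrue
  let es := @Language.Equiv.symm L ℕ Q B hQ e'
  let h' (i : ℕ) : @Language.Embedding L ℕ ℕ S B :=
    @Language.Embedding.comp L ℕ Q S hQ ℕ B (@Language.Equiv.toEmbedding L Q ℕ hQ B es) (h i)
  have hes (z : Q) (i x : ℕ) (hz : h i x = z) : (h' i).toFun x = es z := hz ▸ rfl
  refine ⟨B, @isUnionOfSigmaOneChain_of_embeddings L ℕ ℕ A S B _ _ h' e hGσ hGn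
    (fun i x => ?_) (fun z => ?_), h3⟩
  · refine Eq.trans ?_ (hes _ i x rfl).symm
    exact hes _ _ _ ((congrArg (h (i + 1)) (hGx i x)).trans (h1 i (i + 1) i.le_succ x))
  · obtain ⟨i, x, hix⟩ := h2 (e' z)
    exact ⟨i, x, (hes _ i x hix).trans (@Language.Equiv.symm_apply_apply L ℕ Q B hQ e' z)⟩

end Construction

/-! ### Computing the construction -/

section Computation

variable {X : Set ℕ}

/-- A sequence that is generated by a recursively enumerable relation has a recursively enumerable
graph. -/
theorem reIn_graph_of_recurrence {γ β : Type*} [Primcodable γ] [Primcodable β] {F : γ → ℕ → β}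
    {r : (γ × ℕ × β) × β → Prop} (hr : REIn X r)
    (h0 : REIn X fun x : γ × β => F x.1 0 = x.2)
    (hF : ∀ c s b, r ((c, s, F c s), b) ↔ F c (s + 1) = b) :
    REIn X fun x : γ × ℕ × β => F x.1 x.2.1 = x.2.2 := by
  let J (x : γ × ℕ × β) (D : List (γ × ℕ × β)) : Prop :=
    (x.2.1 = 0 ∧ F x.1 0 = x.2.2) ∨
      ∃ s b, x.2.1 = s + 1 ∧ (x.1, s, b) ∈ D ∧ r ((x.1, s, b), x.2.2)
  have hJ : REIn X fun x : (γ × ℕ × β) × List (γ × ℕ × β) => J x.1 x.2 := by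
    refine .or (.and (by fun_prop) ?_) (.exists' (.exists' (.and (by fun_prop)
      (.and (by fun_prop) ?_))))
    · exact h0.comp (f := fun x : (γ × ℕ × β) × List (γ × ℕ × β) => (x.1.1, x.1.2.2))
        (by fun_prop)
    · exact hr.comp (f := fun x : (((γ × ℕ × β) × List (γ × ℕ × β)) × ℕ) × β =>
        ((x.1.1.1.1, x.1.2, x.2), x.1.1.1.2.2)) (by fun_prop)
  refine hJ.derivable.of_eq fun x => ⟨fun h => ?_, fun h => ?_⟩
  · induction h with
    | @intro x D h _ ih =>
      obtain ⟨h1, h2⟩ | ⟨s, b, h1, h2, h3⟩ := h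
      · rw [h1, h2]
      · have := ih _ h2
        simp only at this
        rw [← this] at h3
        rw [h1]
        exact (hF _ _ _).1 h3
  · obtain ⟨c, s, b⟩ := x
    simp only at h
    induction s generalizing b with
    | zero => exact .intro [] (.inl ⟨rfl, h⟩) (by simp)
    | succ s ih =>
      refine .intro [(c, s, F c s)] (.inr ⟨s, F c s, rfl, by simp, (hF _ _ _).2 h⟩) ?_
      simpa using ih _ rfl

variable [S : L.Structure ℕ] (hS : ComputableIn (oracleOf X) (charFun (atomicDiagram S)))
include hS

/-- An arbitrary embedding of a finitely generated structure is determined by finite information: it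
sends the value of a term at `a` to the value of the same term at `a.map g`. -/
theorem reIn_graph_of_embedding {a : List ℕ} (ha : a ≠ [])
    (hgen : ∀ x, ∃ t : L.Term ℕ, t.realize (entry a) = x) (g : ℕ ↪[L] ℕ) :
    REIn X fun x : ℕ × ℕ => g x.1 = x.2 := by
  have h : REIn X fun x : ℕ × ℕ => ∃ w, TermValue S a w x.1 ∧ TermValue S (a.map g) w x.2 :=
    .exists' (.and (reIn_termValue hS (by fun_prop) (by fun_prop) (by fun_prop))
      (reIn_termValue hS (by fun_prop) (by fun_prop) (by fun_prop)))
  have key (t : L.Term ℕ) : t.realize (entry (a.map g)) = g (t.realize (entry a)) := by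
    rw [← HomClass.realize_term]
    congr 1
    funext m
    exact entry_map g ha m
  refine h.of_eq fun x => ⟨?_, fun hx => ?_⟩
  · rintro ⟨w, h1, h2⟩
    obtain ⟨t, rfl, ht⟩ := termValue_iff.1 h1
    obtain ⟨t', ht', h3⟩ := termValue_iff.1 h2
    rw [Encodable.encode_injective ht', key, ht] at h3
    exact h3
  · obtain ⟨t, ht⟩ := hgen x.1
    exact ⟨_, termValue_iff.2 ⟨t, rfl, ht⟩, termValue_iff.2 ⟨t, rfl, by rw [key, ht, hx]⟩⟩

/-- Events must be decidable: a step refers both to the event that occurs and to the absence of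
smaller ones. -/
theorem reIn_step {g : ℕ → ℕ} (hg : REIn X fun x : ℕ × ℕ => g x.1 = x.2)
    {ev : ℕ → ℕ → ℕ → Prop} (hev : REIn X fun x : ℕ × ℕ × ℕ => ev x.1 x.2.1 x.2.2)
    (hev' : REIn X fun x : ℕ × ℕ × ℕ => ¬ ev x.1 x.2.1 x.2.2) :
    REIn X fun x : (ℕ × ℕ × List (List ℕ)) × List (List ℕ) =>
      Step S g (ev x.1.1) x.1.2.1 x.1.2.2 x.2 := by
  have hiter : REIn X fun x : ℕ × ℕ × ℕ => g^[x.2.1] x.1 = x.2.2 := by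
    refine reIn_graph_of_recurrence (F := fun x j => g^[j] x) (r := fun x => g x.1.2.2 = x.2)
      (hg.comp (f := fun x : (ℕ × ℕ × ℕ) × ℕ => (x.1.2.2, x.2)) (by fun_prop))
      (by simp only [Function.iterate_zero, id]; fun_prop) fun c s b => ?_
    simp only [Function.iterate_succ_apply']
  unfold Step NextLevel MapPrefix Agree
  refine .exists' (.exists' (.and (by fun_prop) (.and (.and (by fun_prop) (.and (.or (by fun_prop)
    ?_) (.forall_lt (by fun_prop) ?_))) (.and (by fun_prop) (.and (by fun_prop) (.and
    (.or (by fun_prop) (.and (by fun_prop) (.forall_lt (by fun_prop) ?_))) (.and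
    (.forall_lt (by fun_prop) (.forall_lt (by fun_prop) (.exists' (.and (by fun_prop) ?_))))
    (.forall_lt (by fun_prop) (.or (.and ?_ ?_) (.or (.and ?_ ?_) (.and ?_ ?_)))))))))))
  · exact hev.comp (f := fun y : (((ℕ × ℕ × List (List ℕ)) × List (List ℕ)) × ℕ) × List ℕ =>
      (y.1.1.1.1, y.1.2, y.1.1.1.2.1)) (by fun_prop)
  · exact hev'.comp
      (f := fun y : ((((ℕ × ℕ × List (List ℕ)) × List (List ℕ)) × ℕ) × List ℕ) × ℕ =>
      (y.1.1.1.1.1, y.2, y.1.1.1.1.2.1)) (by fun_prop)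
  · exact hg.comp
      (f := fun y : ((((ℕ × ℕ × List (List ℕ)) × List (List ℕ)) × ℕ) × List ℕ) × ℕ =>
      (entry (lev y.1.1.1.1.2.2 (y.1.1.2 - 1)) y.2, entry y.1.2 y.2)) (by fun_prop)
  · exact hiter.comp
      (f := fun y : ((((((ℕ × ℕ × List (List ℕ)) × List (List ℕ)) × ℕ) × List ℕ) × ℕ) × ℕ) × ℕ =>
      (y.1.2, y.1.1.2, y.2)) (by fun_prop)
  · exact reIn_not_trueCode hS (by fun_prop)
  · exact reIn_not_falseCode hS (by fun_prop)
  · exact reIn_trueCode hS (by fun_prop)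
  · exact reIn_trueCode hS (by fun_prop)
  · exact reIn_falseCode hS (by fun_prop)
  · exact reIn_falseCode hS (by fun_prop)

/-- The construction can be carried out computably in `X`. -/
theorem exists_computable_stacks {g : ℕ ↪[L] ℕ} (hgraph : REIn X fun x : ℕ × ℕ => g x.1 = x.2)
    (hg : IsSigmaOneElementary g) {ev : ℕ → ℕ → ℕ → Prop}
    (hev : REIn X fun x : ℕ × ℕ × ℕ => ev x.1 x.2.1 x.2.2)
    (hev' : REIn X fun x : ℕ × ℕ × ℕ => ¬ ev x.1 x.2.1 x.2.2) :
    ∃ T : ℕ → ℕ → List (List ℕ), (∀ n, T n 0 = [List.nil]) ∧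
      (∀ n s, Step S g (ev n) s (T n s) (T n (s + 1))) ∧
      REIn X fun x : ℕ × ℕ × List (List ℕ) => T x.1 x.2.1 = x.2.2 := by
  classical
  obtain ⟨q, hq, hqs, huniq, hdom⟩ := (reIn_step hS hgraph hev hev').exists_uniformization
  -- The default `[]` is never used along the run, where `StackInv` guarantees a next stack.
  let next (n s : ℕ) (U : List (List ℕ)) : List (List ℕ) :=
    if h : ∃ U', q ((n, s, U), U') then h.choose else []
  let T (n s : ℕ) : List (List ℕ) := Nat.rec [List.nil] (fun s U => next n s U) s
  have hnext (n s : ℕ) (U : List (List ℕ)) (hU : StackInv g s U) :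
      q ((n, s, U), next n s U) := by
    have h : ∃ U', q ((n, s, U), U') := 
      hdom (n, s, U) (show ∃ U', Step S g (ev n) s U U' from hU.exists_step hg)
    simp only [next, dif_pos h]
    exact h.choose_spec
  have hinv (n s : ℕ) : StackInv g s (T n s) := by
    induction s with
    | zero => exact stackInv_zero g
    | succ s ih => exact (hqs _ (hnext n s _ ih)).stackInv ih
  have hT (n s : ℕ) : q ((n, s, T n s), T n (s + 1)) := hnext n s _ (hinv n s)
  refine ⟨T, fun n => rfl, fun n s => hqs _ (hT n s), reIn_graph_of_recurrence hq ?_ ?_⟩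
  · change REIn X fun x : ℕ × List (List ℕ) => [List.nil] = x.2
    fun_prop
  · exact fun n s U => ⟨fun h => huniq _ _ _ (hT n s) h, fun h => h ▸ hT n s⟩

end Computation

end IndexSets

/-! ### The reduction -/

namespace IndexSets

open FirstOrder Language

variable {L : FirstOrder.Language.{u, v}}

/-- A structure with domain `ℕ` is determined by the atomic sentences that hold in it. -/
theorem structure_eq_of_holds_iff {B B' : L.Structure ℕ}
    (h : ∀ φ : AtomicSentence L, φ.Holds B ↔ φ.Holds B') : B = B' := by
  refine Structure.ext ?_ ?_
  · funext n F x
    exact ((h (.equal (.func F fun i => .var (x i)) (.var (B.funMap F x)))).1 rfl).symm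
  · funext n R x
    exact propext (h (.rel R fun i => .var (x i)))

section

variable [Encodable ((n : ℕ) × L.Functions n)] [Encodable ((n : ℕ) × L.Relations n)] {X : Set ℕ}

/-- Truth is recovered from the even part of the diagram. An index cannot give another structure as
well, which excludes accidental membership in the index set. -/
theorem GivesDiagram.structure_eq {e : ℕ} {B B' : L.Structure ℕ} (h : GivesDiagram X e B)
    (h' : GivesDiagram X e B') : B = B' := by
  classical
  have heq (c : ℕ) : c ∈ atomicDiagram B ↔ c ∈ atomicDiagram B' := by
    have h1 := Part.some_injective ((h c).symm.trans (h' c))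
    rw [charFun_apply, charFun_apply] at h1
    split_ifs at h1 <;> simp_all
  refine structure_eq_of_holds_iff fun φ => ?_
  have key (B : L.Structure ℕ) : TrueCode B φ.code ↔ φ.Holds B := by
    rw [trueCode_iff]
    exact ⟨fun ⟨ψ, h1, h2⟩ => AtomicSentence.code_injective h1 ▸ h2, fun h => ⟨φ, rfl, h⟩⟩
  rw [← key, ← key]
  exact heq _

end

/-! ### Events of a `Σ⁰₃` definition -/

/-- The number `s` codes the list of the least witnesses of `R 0, R 1, …`, up to some length. -/
def CodesLeastWitnesses (R : ℕ → ℕ → Bool) (s : ℕ) : Prop :=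
  ∀ i < (Denumerable.ofNat (List ℕ) s).length,
    R i (entry (Denumerable.ofNat (List ℕ) s) i) = true ∧
      ∀ c < entry (Denumerable.ofNat (List ℕ) s) i, R i c = false

/-- Leastness leaves at most one list of each length, so there are infinitely many codes iff the
lists get arbitrarily long, that is, iff every `b` has a witness. -/
theorem infinite_codesLeastWitnesses_iff {R : ℕ → ℕ → Bool} :
    {s | CodesLeastWitnesses R s}.Infinite ↔ ∀ b, ∃ c, R b c = true := by
  classical
  constructor
  · refine fun h => by_contra fun hb => h ?_
    push Not at hb
    obtain ⟨b, hb⟩ := hb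
    have hlen (s : ℕ) (hs : CodesLeastWitnesses R s) :
        (Denumerable.ofNat (List ℕ) s).length ≤ b := by
      by_contra! hlt
      exact hb _ (hs b hlt).1
    refine Set.Finite.of_finite_image (f := fun s => (Denumerable.ofNat (List ℕ) s).length)
      ((Set.finite_Iic b).subset (by rintro _ ⟨s, hs, rfl⟩; exact hlen s hs)) ?_
    intro s hs s' hs' heq
    simp only at heq
    suffices hl : Denumerable.ofNat (List ℕ) s = Denumerable.ofNat (List ℕ) s' from
      (Denumerable.eqv (List ℕ)).symm.injective hl
    refine List.ext_getElem heq fun i h1 h2 => ?_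
    obtain ⟨h3, h4⟩ := hs i h1
    obtain ⟨h5, h6⟩ := hs' i h2
    rw [entry_of_lt h1] at h3 h4
    rw [entry_of_lt h2] at h5 h6
    refine le_antisymm ?_ ?_ <;> by_contra! hlt
    · simp [h4 _ hlt] at h5
    · simp [h6 _ hlt] at h3
  · intro h
    let l (n : ℕ) : List ℕ := (List.range n).map fun b => Nat.find (h b)
    refine Set.infinite_of_injective_forall_mem (f := fun n => Encodable.encode (l n))
      (fun n m hnm => ?_) fun n => ?_
    · simpa [l] using congrArg List.length (Encodable.encode_injective hnm)
    · intro i hi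
      rw [Denumerable.ofNat_encode] at hi ⊢
      have h1 : entry (l n) i = Nat.find (h i) := by
        rw [entry_of_lt hi]
        simp [l]
      rw [h1]
      exact ⟨Nat.find_spec (h i), fun c hc => by simpa using Nat.find_min (h i) hc⟩

section

variable {X : Set ℕ} {R : ℕ → ℕ → ℕ → ℕ → Bool}
  (hR : ComputableIn (oracleOf X) fun p : ℕ × ℕ × ℕ × ℕ => R p.1 p.2.1 p.2.2.1 p.2.2.2)
include hR

theorem reIn_eq_bool (v : Bool) : REIn X fun x : ℕ × ℕ × ℕ × ℕ => R x.1 x.2.1 x.2.2.1 x.2.2.2 = v :=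
  (reIn_graph_of_computableIn hR).comp (f := fun x : ℕ × ℕ × ℕ × ℕ => (x, v)) (by fun_prop)

theorem reIn_codesLeastWitnesses :
    REIn X fun x : ℕ × ℕ × ℕ => CodesLeastWitnesses (R x.1 x.2.1) x.2.2 := by
  unfold CodesLeastWitnesses
  refine .forall_lt (by fun_prop) (.and ?_ (.forall_lt (by fun_prop) ?_))
  · exact (reIn_eq_bool hR true).comp (f := fun y : (ℕ × ℕ × ℕ) × ℕ => (y.1.1, y.1.2.1, y.2,
      entry (Denumerable.ofNat (List ℕ) y.1.2.2) y.2)) (by fun_prop)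
  · exact (reIn_eq_bool hR false).comp
      (f := fun y : ((ℕ × ℕ × ℕ) × ℕ) × ℕ => (y.1.1.1, y.1.1.2.1, y.1.2, y.2)) (by fun_prop)

theorem reIn_not_codesLeastWitnesses :
    REIn X fun x : ℕ × ℕ × ℕ => ¬ CodesLeastWitnesses (R x.1 x.2.1) x.2.2 := by
  have h : REIn X fun x : ℕ × ℕ × ℕ => ∃ i, i < (Denumerable.ofNat (List ℕ) x.2.2).length ∧
      (R x.1 x.2.1 i (entry (Denumerable.ofNat (List ℕ) x.2.2) i) = false ∨
        ∃ c, c < entry (Denumerable.ofNat (List ℕ) x.2.2) i ∧ R x.1 x.2.1 i c = true) := by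
    refine .exists' (.and (by fun_prop) (.or ?_ (.exists' (.and (by fun_prop) ?_))))
    · exact (reIn_eq_bool hR false).comp (f := fun y : (ℕ × ℕ × ℕ) × ℕ => (y.1.1, y.1.2.1, y.2,
        entry (Denumerable.ofNat (List ℕ) y.1.2.2) y.2)) (by fun_prop)
    · exact (reIn_eq_bool hR true).comp
        (f := fun y : ((ℕ × ℕ × ℕ) × ℕ) × ℕ => (y.1.1.1, y.1.1.2.1, y.1.2, y.2)) (by fun_prop)
  refine h.of_eq fun x => ?_
  simp only [CodesLeastWitnesses, not_forall, not_and_or, exists_prop, Bool.not_eq_true,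
    Bool.not_eq_false]

end

variable [Encodable ((n : ℕ) × L.Functions n)] [Encodable ((n : ℕ) × L.Relations n)]

/-- The case distinction on `n ∈ P` occurs only in identifying the limit; the construction is the
same for all `n`. -/
theorem exists_computable_givesDiagram {X : Set ℕ} {A : Type w} [L.Structure A]
    (hfg : Structure.FG L A) (hA : XComputable X L A) (hsr : SelfReflective L A)
    {P : Set ℕ} (hP : IsSigma3 X P) :
    ∃ f : ℕ → ℕ, Computable f ∧ ∀ n, ∃ B : L.Structure ℕ, GivesDiagram X (f n) B ∧
      (n ∈ P → Nonempty (@Language.Equiv L ℕ A B _)) ∧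
      (n ∉ P → ¬ @Structure.FG L ℕ B ∧ @IsUnionOfSigmaOneChain L ℕ B A _) := by
  obtain ⟨S, hS, ⟨i⟩⟩ := hA
  obtain ⟨R, hR, hRP⟩ := hP
  obtain ⟨a, ha, hgen⟩ := exists_generating_list ((Equiv.fg_iff i).2 hfg)
  obtain ⟨g, hg, hg'⟩ := hsr.exists_embedding i
  obtain ⟨T, hT0, hT, hTre⟩ := exists_computable_stacks hS (reIn_graph_of_embedding hS ha hgen g) hg
    (ev := fun n b s => CodesLeastWitnesses (R n b) s)
    (reIn_codesLeastWitnesses hR) (reIn_not_codesLeastWitnesses hR)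
  have hinf (n : ℕ) : n ∈ P ↔ ∃ b, {s | CodesLeastWitnesses (R n b) s}.Infinite := by
    simp only [hRP, infinite_codesLeastWitnesses_iff]
  have hB (n : ℕ) : ∃ B : L.Structure ℕ,
      ((n ∈ P → Nonempty (@Language.Equiv L ℕ A B _)) ∧
        (n ∉ P → ¬ @Structure.FG L ℕ B ∧ @IsUnionOfSigmaOneChain L ℕ B A _)) ∧
      ∀ c v, DiagramValue S (top (T n (c + 1))) c v ↔ charFun (atomicDiagram B) c = v := by
    by_cases hn : n ∈ P
    · obtain ⟨B, ⟨e⟩, h⟩ := exists_structure_of_infinite (hT0 n) (hT n) ((hinf n).1 hn)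
      exact ⟨B, ⟨fun _ => ⟨@Language.Equiv.comp L ℕ ℕ B S A _ i
        (@Language.Equiv.symm L ℕ ℕ S B e)⟩, fun h => absurd hn h⟩, h⟩
    · obtain ⟨B, h1, h⟩ := exists_structure_of_finite (hT0 n) (hT n) i hg hg' fun b =>
        Set.not_infinite.1 fun hb => hn ((hinf n).2 ⟨b, hb⟩)
      exact ⟨B, ⟨fun h => absurd h hn, fun _ => h1⟩, h⟩
  choose B hB1 hB2 using hB
  -- Although `B` was chosen by cases, its diagram is read uniformly from the stack at stage `c +
  -- 1`.
  have hD : REIn X fun x : (ℕ × ℕ) × ℕ => charFun (atomicDiagram (B x.1.1)) x.1.2 = x.2 := by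
    have h : REIn X fun x : (ℕ × ℕ) × ℕ =>
        ∃ U, T x.1.1 (x.1.2 + 1) = U ∧ DiagramValue S (top U) x.1.2 x.2 :=
      .exists' (.and (hTre.comp (f := fun y : ((ℕ × ℕ) × ℕ) × List (List ℕ) =>
        (y.1.1.1, y.1.1.2 + 1, y.2)) (by fun_prop))
        (reIn_diagramValue hS (by fun_prop) (by fun_prop) (by fun_prop)))
    exact h.of_eq fun x => by simp [← hB2]
  obtain ⟨f, hf, hfD⟩ :=
    exists_computable_Phi_eq (D := fun n c => charFun (atomicDiagram (B n)) c) hD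
  exact ⟨f, hf, fun n => ⟨B n, hfD n, hB1 n⟩⟩

end IndexSets

theorem mainTheorem3 {L : FirstOrder.Language.{u, v}}
    [Encodable ((n : ℕ) × L.Functions n)] [Encodable ((n : ℕ) × L.Relations n)]
    (X : Set ℕ) (hL : IndexSets.XComputableLanguage L X)
    (A : Type w) [L.Structure A]
    (hfg : FirstOrder.Language.Structure.FG L A)
    (hA : IndexSets.XComputable X L A) (hsr : IndexSets.SelfReflective L A) :
    IndexSets.IsSigma3Complete X (IndexSets.indexSet X L A) ∧
    ∀ S : Set ℕ, IndexSets.IsSigma3 X S →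
      ∃ f : ℕ → ℕ, Computable f ∧ ∀ n, ∃ B : L.Structure ℕ,
        IndexSets.GivesDiagram X (f n) B ∧
        (n ∈ S → Nonempty (ℕ ≃[L] A)) ∧
        (n ∉ S → ¬ FirstOrder.Language.Structure.FG L ℕ ∧
          IndexSets.IsUnionOfSigmaOneChain L ℕ A) := by
  refine ⟨⟨IndexSets.isSigma3_indexSet hfg hA, fun S hS => ?_⟩,
    fun S hS => IndexSets.exists_computable_givesDiagram hfg hA hsr hS⟩
  obtain ⟨f, hf, h⟩ := IndexSets.exists_computable_givesDiagram hfg hA hsr hS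
  refine ⟨f, hf, fun n => ?_⟩
  obtain ⟨B, h1, h2, h3⟩ := h n
  refine ⟨fun hn => ⟨B, h1, h2 hn⟩, ?_⟩
  rintro ⟨B', h1', ⟨e⟩⟩
  -- The copy of `A` given by this index is the constructed structure, so finite generation
  -- contradicts the case `n ∉ S`.
  obtain rfl := h1.structure_eq h1'
  by_contra hn
  exact (h3 hn).1 ((FirstOrder.Language.Equiv.fg_iff e).2 hfg)
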